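/- Let $\mathcal G$ be a hereditary family of finite simple undirected graphs, that is, a family closed under isomorphism and under taking induced subgraphs. An instance of $\mathcal G$-Sb-CFFA consists of a set $\mathcal A$ of $n$ agents, a set $\mathcal I$ of $m$ jobs, a utility function $u_a\colon \mathcal I\to\mathbb N$ for each agent $a\in\mathcal A$, positive integers $s$ and $\eta$, and a graph $\mathcal H\in\mathcal G$ with vertex set $\mathcal I$. The question is whether there is a function $\phi\colon\mathcal A\to 2^{\mathcal I}$ such that for every $a\in\mathcal A$ the bundle $\phi(a)$ is an independent set in $\mathcal H$, $|\phi(a)|\le s$ and $\sum_{x\in\phi(a)}u_a(x)\ge\eta$, and $\phi(a)\cap\phi(a')=\emptyset$ for all distinct $a,a'\in\mathcal A$. An instance of $\mathcal G$-Sb-MWIS consists of a graph $G\in\mathcal G$, positive integers $k$ and $\rho$, and a weight function $w\colon V(G)\to\mathbb N$. The question is whether $G$ has an independent set $S$ with $|S|\le k$ and $\sum_{v\in S}w(v)\ge\rho$. A problem whose instances $I$ have a parameter $\kappa(I)\in\mathbb N$ is called FPT if there are a deterministic algorithm, a computable function $f\colon\mathbb N\to\mathbb N$ and a constant $c$ such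 that the algorithm decides every instance $I$ of the problem correctly in at most $f(\kappa(I))\cdot|I|^{c}$ steps, where $|I|$ is the size of the input (graphs given by adjacency matrices, numbers in binary) and steps are counted on a machine model that is polynomially equivalent to Turing machines. Nothing is required of the algorithm on inputs whose graph is not in $\mathcal G$. Then $\mathcal G$-Sb-CFFA is FPT parameterized by $n+s$ if and only if $\mathcal G$-Sb-MWIS is FPT parameterized by $k$. -/

import Mathlib

/-! ### Binary trees (S-expressions): the data on which programs operate -/

/-- Binary trees with unlabelled nodes, i.e. S-expressions over the single atom `nil`. -/
inductive SExp : Type where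
  | nil : SExp
  | cons : SExp → SExp → SExp

namespace SExp

/-- The number of nodes (inner nodes and leaves) of a tree. -/
def size : SExp → ℕ
  | nil => 1
  | cons a b => a.size + b.size + 1

/-- The first component of a pair (`nil` for the atom). -/
def head : SExp → SExp
  | nil => nil
  | cons a _ => a

/-- The second component of a pair (`nil` for the atom). -/
def tail : SExp → SExp
  | nil => nil
  | cons _ b => b

/-- The list `[a₁, …, aₗ]` as the tree `cons a₁ (cons a₂ (… nil))`. -/
def ofList : List SExp → SExp
  | [] => nil
  | a :: l => cons a (ofList l)

/-- Truth values. -/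
def ofBool : Bool → SExp
  | false => nil
  | true => cons nil nil

/-- Natural numbers are written in binary, least significant bit first. -/
def ofNat (n : ℕ) : SExp := ofList (n.bits.map ofBool)

/-- A finite sequence of natural numbers, each written in binary. -/
def ofVector {m : ℕ} (v : Fin m → ℕ) : SExp := ofList (List.ofFn fun i => ofNat (v i))

open Classical in
/-- A graph on the vertices `0, …, m - 1`, written as its `m × m` adjacency matrix. -/
noncomputable def ofGraph {m : ℕ} (G : SimpleGraph (Fin m)) : SExp :=
  ofList (List.ofFn fun i => ofList (List.ofFn fun j => ofBool (decide (G.Adj i j))))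

end SExp

/-! ### The machine model: deterministic WHILE programs with a step count

This is the WHILE language of N. Jones (Computability and Complexity from a Programming
Perspective), equivalently a pure Lisp / pointer machine: finitely many variables holding binary
trees, elementary operations `nil`, copy, `cons`, `head`, `tail`, and a test whether a variable is
`nil`. Every elementary operation and every test takes one step. As trees can be represented by
pointers into a shared structure and only the root of a tree is ever inspected, each step is
carried out by a Turing machine in time polynomial in the input size and in the number of steps
done so far; conversely a Turing machine is simulated with constant overhead. So the time measure
is polynomially equivalent to Turing machine time. -/

/-- WHILE programs; variables are named by natural numbers. -/
inductive WhileProg : Type where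
  /-- `x := nil` -/
  | setNil (x : ℕ) : WhileProg
  /-- `x := y` -/
  | copy (x y : ℕ) : WhileProg
  /-- `x := cons y z` -/
  | cons (x y z : ℕ) : WhileProg
  /-- `x := head y` -/
  | head (x y : ℕ) : WhileProg
  /-- `x := tail y` -/
  | tail (x y : ℕ) : WhileProg
  /-- `p; q` -/
  | seq (p q : WhileProg) : WhileProg
  /-- `if x ≠ nil then p else q` -/
  | ite (x : ℕ) (p q : WhileProg) : WhileProg
  /-- `while x ≠ nil do p` -/
  | loop (x : ℕ) (p : WhileProg) : WhileProg

namespace WhileProg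

/-- The contents of the variables. -/
abbrev Store : Type := ℕ → SExp

/-- At the start, variable `0` holds the input and every other variable holds `nil`. -/
def initStore (input : SExp) : Store := Function.update (fun _ => SExp.nil) 0 input

/-- `Exec p σ t τ`: started in store `σ`, the program `p` halts after exactly `t` steps, in the
store `τ`. -/
inductive Exec : WhileProg → Store → ℕ → Store → Prop where
  | setNil (x : ℕ) (σ : Store) : Exec (.setNil x) σ 1 (Function.update σ x SExp.nil)
  | copy (x y : ℕ) (σ : Store) : Exec (.copy x y) σ 1 (Function.update σ x (σ y))
  | cons (x y z : ℕ) (σ : Store) :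
      Exec (.cons x y z) σ 1 (Function.update σ x (SExp.cons (σ y) (σ z)))
  | head (x y : ℕ) (σ : Store) : Exec (.head x y) σ 1 (Function.update σ x (σ y).head)
  | tail (x y : ℕ) (σ : Store) : Exec (.tail x y) σ 1 (Function.update σ x (σ y).tail)
  | seq {p q : WhileProg} {σ τ υ : Store} {t u : ℕ}
      (hp : Exec p σ t τ) (hq : Exec q τ u υ) : Exec (.seq p q) σ (t + u) υ
  | ite_true {x : ℕ} {p q : WhileProg} {σ τ : Store} {t : ℕ}
      (hx : σ x ≠ SExp.nil) (hp : Exec p σ t τ) : Exec (.ite x p q) σ (t + 1) τ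
  | ite_false {x : ℕ} {p q : WhileProg} {σ τ : Store} {t : ℕ}
      (hx : σ x = SExp.nil) (hq : Exec q σ t τ) : Exec (.ite x p q) σ (t + 1) τ
  | loop_exit {x : ℕ} {p : WhileProg} {σ : Store}
      (hx : σ x = SExp.nil) : Exec (.loop x p) σ 1 σ
  | loop_iter {x : ℕ} {p : WhileProg} {σ τ υ : Store} {t u : ℕ}
      (hx : σ x ≠ SExp.nil) (hp : Exec p σ t τ) (hl : Exec (.loop x p) τ u υ) :
      Exec (.loop x p) σ (t + u + 1) υ

end WhileProg

/-! ### Parameterized problems and fixed-parameter tractability -/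

/-- A parameterized decision problem: its instances, the way they are written as input, the
parameter of an instance, and the yes-instances. -/
structure ParamProblem where
  /-- the instances -/
  Inst : Type
  /-- the input that represents an instance -/
  encode : Inst → SExp
  /-- the parameter -/
  param : Inst → ℕ
  /-- the yes-instances -/
  IsYes : Inst → Prop

/-- Fixed-parameter tractability: one program decides every instance `I` in at most
`f (param I) * |I| ^ c` steps, where `f` is computable, `c` is a constant and `|I|` is the size of
the input. The answer is yes if variable `0` is not `nil` at the end. -/
def ParamProblem.IsFPT (P : ParamProblem) : Prop :=
  ∃ (p : WhileProg) (f : ℕ → ℕ) (c : ℕ), Computable f ∧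
    ∀ I : P.Inst, ∃ (t : ℕ) (τ : WhileProg.Store),
      WhileProg.Exec p (WhileProg.initStore (P.encode I)) t τ ∧
      t ≤ f (P.param I) * (P.encode I).size ^ c ∧
      (τ 0 ≠ SExp.nil ↔ P.IsYes I)

/-! ### Graph families -/

/-- A family of finite (simple, undirected) graphs, with vertices `0, …, m - 1`. -/
abbrev GraphFamily : Type := Set (Σ m : ℕ, SimpleGraph (Fin m))

/-- A family is hereditary if it is closed under taking induced subgraphs. Induced subgraphs are
taken up to isomorphism: `H ↪g G` says that `H` is isomorphic to an induced subgraph of `G`. -/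
def GraphFamily.Hereditary (𝒢 : GraphFamily) : Prop :=
  ∀ (m l : ℕ) (G : SimpleGraph (Fin m)) (H : SimpleGraph (Fin l)),
    ⟨m, G⟩ ∈ 𝒢 → Nonempty (H ↪g G) → ⟨l, H⟩ ∈ 𝒢

/-! ### Size bounded maximum weight independent set -/

/-- An instance `(G, k, ρ, w)`. -/
structure MWISInstance where
  /-- number of vertices -/
  m : ℕ
  graph : SimpleGraph (Fin m)
  /-- size bound -/
  k : ℕ
  /-- weight to be reached -/
  ρ : ℕ
  weight : Fin m → ℕ
  k_pos : 0 < k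
  ρ_pos : 0 < ρ

/-- There is an independent set of size at most `k` and weight at least `ρ`. -/
def MWISInstance.IsYes (I : MWISInstance) : Prop :=
  ∃ S : Finset (Fin I.m),
    I.graph.IsIndepSet (S : Set (Fin I.m)) ∧ S.card ≤ I.k ∧ I.ρ ≤ ∑ v ∈ S, I.weight v

/-- The instance as input data. -/
noncomputable def MWISInstance.encode (I : MWISInstance) : SExp :=
  SExp.ofList [SExp.ofGraph I.graph, SExp.ofNat I.k, SExp.ofNat I.ρ, SExp.ofVector I.weight]

/-- The restriction of the problem to graphs of the family `𝒢`, parameterized by `k`. -/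
noncomputable def sbMWIS (𝒢 : GraphFamily) : ParamProblem where
  Inst := {I : MWISInstance // ⟨I.m, I.graph⟩ ∈ 𝒢}
  encode I := I.1.encode
  param I := I.1.k
  IsYes I := I.1.IsYes

/-! ### Size bounded conflict-free fair allocation -/

/-- An instance with agents `0, …, n - 1`, jobs `0, …, m - 1`, a utility function for each agent,
a conflict graph on the jobs, bundle size bound `s` and target utility `η`. -/
structure CFFAInstance where
  /-- number of agents -/
  n : ℕ
  /-- number of jobs -/
  m : ℕ
  utility : Fin n → Fin m → ℕ
  /-- bundle size bound -/
  s : ℕ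
  /-- target utility -/
  η : ℕ
  /-- conflict graph -/
  graph : SimpleGraph (Fin m)
  s_pos : 0 < s
  η_pos : 0 < η

/-- There are pairwise disjoint bundles, one for each agent, each of which is an independent set
of size at most `s` and has utility at least `η` for its agent. -/
def CFFAInstance.IsYes (J : CFFAInstance) : Prop :=
  ∃ φ : Fin J.n → Finset (Fin J.m),
    (∀ a, J.graph.IsIndepSet (φ a : Set (Fin J.m)) ∧ (φ a).card ≤ J.s ∧
      J.η ≤ ∑ x ∈ φ a, J.utility a x) ∧
    ∀ a b, a ≠ b → Disjoint (φ a) (φ b)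

/-- The instance as input data. -/
noncomputable def CFFAInstance.encode (J : CFFAInstance) : SExp :=
  SExp.ofList [SExp.ofGraph J.graph, SExp.ofNat J.s, SExp.ofNat J.η,
    SExp.ofList (List.ofFn fun a => SExp.ofVector (J.utility a))]

/-- The restriction of the problem to conflict graphs of the family `𝒢`, parameterized by
`n + s`. -/
noncomputable def sbCFFA (𝒢 : GraphFamily) : ParamProblem where
  Inst := {J : CFFAInstance // ⟨J.m, J.graph⟩ ∈ 𝒢}
  encode J := J.1.encode
  param J := J.1.n + J.1.s
  IsYes J := J.1.IsYes

/-!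
From MWIS to CFFA there is nothing to do: an instance of MWIS is an instance of CFFA with a single
agent, and only the encoding has to be rearranged (`sbMWIS_isFPT_of_sbCFFA`).

For the converse, a decision procedure for MWIS tells whether a vertex set `U` contains an
admissible bundle for an agent, since induced subgraphs stay in the hereditary family
(`MWISInstance.induce_isYes`, `MWISInstance.induce_mem`). By self-reduction it also finds one
(`shrink_spec`): vertices are deleted as long as a bundle remains. With this, CFFA is solved by a
bounded search tree that serves the agents one after the other. Let `a` be the first agent, `F` the
set of free vertices and `R` the set of vertices already promised to `a`. Collect greedily up to
`n * s` admissible bundles for `a` in `R ∪ F` that are pairwise disjoint outside `R` (`pack`).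

* If `n * s` bundles are found, then `a` is dropped: the other agents need at most `(n - 1) * s`
  vertices of `F`, so one of the bundles remains untouched by them
  (`exists_disjoint_of_pack`).
* Otherwise each admissible bundle for `a` in `R ∪ F` meets the at most `n * s * s` free vertices of
  the bundles found. Branch over a vertex of the intersection, which is promised to `a`. As
  bundles have at most `s` vertices, this happens at most `s` times for each agent.

The correctness of the branching consists of `SearchNode.Solvable.of_children` and
`SearchNode.Promising.exists_child`; `SearchNode.sum_weight_children_lt` bounds the size of the tree
in terms of `n` and `s`. The decision procedure is called with the original bounds `s` and `η` only,
on subsets of the vertices, so that the programs need no arithmetic on weights.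

To write the programs, WHILE programs are regarded as functions of the contents of variable `0`,
with the cost-annotated big-step relation `WhileProg.Ev` and one rule for each of a few combinators
(pairing, case distinction, right folds over one or two lists, loops, calls of a given program).
Vertex sets are represented by bit masks in parallel to the rows of the adjacency matrix, and the
loop counters by unary numbers.
-/

/-! ### Variables of programs -/

namespace WhileProg

/-- A strict bound for the variables that occur in a program; it is positive. -/
def bound : WhileProg → ℕ
  | .setNil x => x + 1
  | .copy x y => max (x + 1) (y + 1)
  | .cons x y z => max (x + 1) (max (y + 1) (z + 1))
  | .head x y => max (x + 1) (y + 1)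
  | .tail x y => max (x + 1) (y + 1)
  | .seq p q => max p.bound q.bound
  | .ite x p q => max (x + 1) (max p.bound q.bound)
  | .loop x p => max (x + 1) p.bound

theorem bound_pos (p : WhileProg) : 0 < p.bound := by
  induction p <;> (simp [bound]; try omega)

theorem Exec.frame {p : WhileProg} {σ τ : Store} {t : ℕ} (h : Exec p σ t τ) :
    ∀ v, p.bound ≤ v → τ v = σ v := by
  induction h with
  | seq _ _ ih₁ ih₂ =>
    intro v hv
    simp only [bound, max_le_iff] at hv
    rw [ih₂ v hv.2, ih₁ v hv.1]
  | ite_true _ _ ih | ite_false _ _ ih =>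
    intro v hv
    simp only [bound, max_le_iff] at hv
    exact ih v (by tauto)
  | loop_exit _ => intros; rfl
  | loop_iter _ _ _ ih₁ ih₂ =>
    intro v hv
    rw [ih₂ v hv]
    simp only [bound, max_le_iff] at hv
    exact ih₁ v hv.2
  | _ =>
    intro v hv
    simp only [bound, max_le_iff] at hv
    exact Function.update_of_ne (by omega) _ _

/-- A run depends only on the variables that occur in the program. -/
theorem Exec.congr {p : WhileProg} {σ τ : Store} {t : ℕ} (h : Exec p σ t τ) {N : ℕ} :
    p.bound ≤ N → ∀ σ' : Store, (∀ v < N, σ' v = σ v) →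
      ∃ τ', Exec p σ' t τ' ∧ ∀ v < N, τ' v = τ v := by
  have key : ∀ (σ σ' : Store) (x : ℕ) (a b : SExp), (∀ v < N, σ' v = σ v) → a = b →
      ∀ v < N, Function.update σ' x a v = Function.update σ x b v := by
    intro σ σ' x a b h hab v hv
    by_cases hx : v = x <;> simp [hx, hab, h v hv]
  induction h with
  | setNil x σ => exact fun _ σ' h => ⟨_, .setNil x σ', key _ _ _ _ _ h rfl⟩
  | copy x y σ =>
    intro hN σ' h
    simp only [bound, max_le_iff] at hN
    exact ⟨_, .copy x y σ', key _ _ _ _ _ h (h _ (by omega))⟩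
  | cons x y z σ =>
    intro hN σ' h
    simp only [bound, max_le_iff] at hN
    exact ⟨_, .cons x y z σ', key _ _ _ _ _ h (by rw [h y (by omega), h z (by omega)])⟩
  | head x y σ =>
    intro hN σ' h
    simp only [bound, max_le_iff] at hN
    exact ⟨_, .head x y σ', key _ _ _ _ _ h (by rw [h y (by omega)])⟩
  | tail x y σ =>
    intro hN σ' h
    simp only [bound, max_le_iff] at hN
    exact ⟨_, .tail x y σ', key _ _ _ _ _ h (by rw [h y (by omega)])⟩
  | seq _ _ ih₁ ih₂ =>
    intro hN σ' h
    simp only [bound, max_le_iff] at hN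
    obtain ⟨τ', e₁, h₁⟩ := ih₁ hN.1 σ' h
    obtain ⟨υ', e₂, h₂⟩ := ih₂ hN.2 τ' h₁
    exact ⟨υ', .seq e₁ e₂, h₂⟩
  | ite_true hx _ ih =>
    intro hN σ' h
    simp only [bound, max_le_iff] at hN
    obtain ⟨τ', e₁, h₁⟩ := ih hN.2.1 σ' h
    exact ⟨τ', .ite_true (by rwa [h _ (by omega)]) e₁, h₁⟩
  | ite_false hx _ ih =>
    intro hN σ' h
    simp only [bound, max_le_iff] at hN
    obtain ⟨τ', e₁, h₁⟩ := ih hN.2.2 σ' h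
    exact ⟨τ', .ite_false (by rwa [h _ (by omega)]) e₁, h₁⟩
  | loop_exit hx =>
    intro hN σ' h
    simp only [bound, max_le_iff] at hN
    exact ⟨σ', .loop_exit (by rwa [h _ (by omega)]), h⟩
  | loop_iter hx _ _ ih₁ ih₂ =>
    intro hN σ' h
    have hN' := hN
    simp only [bound, max_le_iff] at hN
    obtain ⟨τ', e₁, h₁⟩ := ih₁ hN.2 σ' h
    obtain ⟨υ', e₂, h₂⟩ := ih₂ hN' τ' h₁
    exact ⟨υ', .loop_iter (by rwa [h _ (by omega)]) e₁ e₂, h₂⟩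

/-! ### A functional programming layer -/

/-- The program `p`, regarded as a function from the contents of variable `0` at the start to its
contents at the end, maps `x` to `y` within `t` steps, whatever the other variables hold. -/
def Ev (p : WhileProg) (x : SExp) (t : ℕ) (y : SExp) : Prop :=
  ∀ σ : Store, σ 0 = x → ∃ t' ≤ t, ∃ τ, Exec p σ t' τ ∧ τ 0 = y

theorem Ev.mono {p : WhileProg} {x y : SExp} {t t' : ℕ} (h : Ev p x t y) (ht : t ≤ t') :
    Ev p x t' y := by
  intro σ hσ
  obtain ⟨u, hu, τ, e, hτ⟩ := h σ hσ
  exact ⟨u, hu.trans ht, τ, e, hτ⟩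

/-- The identity. -/
def idP : WhileProg := .copy 0 0

theorem Ev.id {x : SExp} : Ev idP x 1 x :=
  fun σ hσ => ⟨1, le_rfl, _, .copy 0 0 σ, by simp [hσ]⟩

/-- The constant `nil`. -/
def nilP : WhileProg := .setNil 0

theorem Ev.nil {x : SExp} : Ev nilP x 1 .nil :=
  fun σ _ => ⟨1, le_rfl, _, .setNil 0 σ, by simp⟩

/-- First component of the value of `p`. -/
def fstP (p : WhileProg) : WhileProg := .seq p (.head 0 0)

theorem Ev.fst {p : WhileProg} {x y : SExp} {t : ℕ} (h : Ev p x t y) :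
    Ev (fstP p) x (t + 1) y.head := by
  intro σ hσ
  obtain ⟨u, hu, τ, e, hτ⟩ := h σ hσ
  exact ⟨u + 1, by omega, _, .seq e (.head 0 0 τ), by simp [hτ]⟩

/-- Second component of the value of `p`. -/
def sndP (p : WhileProg) : WhileProg := .seq p (.tail 0 0)

theorem Ev.snd {p : WhileProg} {x y : SExp} {t : ℕ} (h : Ev p x t y) :
    Ev (sndP p) x (t + 1) y.tail := by
  intro σ hσ
  obtain ⟨u, hu, τ, e, hτ⟩ := h σ hσ
  exact ⟨u + 1, by omega, _, .seq e (.tail 0 0 τ), by simp [hτ]⟩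

/-- Drop the first `i` entries of the input, a list. -/
def dropP : ℕ → WhileProg
  | 0 => idP
  | i + 1 => sndP (dropP i)

/-- The `i`-th entry of the input, a list. -/
def argP (i : ℕ) : WhileProg := fstP (dropP i)

theorem Ev.drop {x : SExp} (i : ℕ) : Ev (dropP i) x (i + 1) (SExp.tail^[i] x) := by
  induction i with
  | zero => exact Ev.id
  | succ i ih =>
    rw [Function.iterate_succ_apply']
    exact ih.snd

theorem Ev.arg {x : SExp} (i : ℕ) : Ev (argP i) x (i + 2) (SExp.tail^[i] x).head :=
  (Ev.drop i).fst

/-- Composition: first `q`, then `p`. -/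
def compP (p q : WhileProg) : WhileProg := .seq q p

theorem Ev.comp {p q : WhileProg} {x y z : SExp} {t u : ℕ} (hp : Ev p y u z)
    (hq : Ev q x t y) : Ev (compP p q) x (t + u) z := by
  intro σ hσ
  obtain ⟨t', ht', τ, e, hτ⟩ := hq σ hσ
  obtain ⟨u', hu', υ, e', hυ⟩ := hp τ hτ
  exact ⟨t' + u', by omega, _, .seq e e', hυ⟩

/-- The pair of the values of `p` and `q`. -/
def pairP (p q : WhileProg) : WhileProg :=
  let N := max p.bound q.bound
  .seq (.copy N 0) (.seq p (.seq (.copy (N + 1) 0) (.seq (.copy 0 N) (.seq q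
    (.cons 0 (N + 1) 0)))))

theorem Ev.pair {p q : WhileProg} {x y z : SExp} {t u : ℕ} (hp : Ev p x t y)
    (hq : Ev q x u z) : Ev (pairP p q) x (t + u + 4) (.cons y z) := by
  intro σ hσ
  have hN₁ : p.bound ≤ max p.bound q.bound := le_max_left _ _
  have hN₂ : q.bound ≤ max p.bound q.bound := le_max_right _ _
  have hN₀ := p.bound_pos
  unfold pairP
  generalize max p.bound q.bound = N at hN₁ hN₂
  obtain ⟨t', ht', τ, e, hτ⟩ := hp (Function.update σ N (σ 0))
    (by simp [Function.update_apply, hσ])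
  have f₁ := e.frame N hN₁
  obtain ⟨u', hu', υ, e', hυ⟩ := hq
    (Function.update (Function.update τ (N + 1) (τ 0)) 0
      (Function.update τ (N + 1) (τ 0) N))
    (by simp [hσ, f₁])
  have f₂ := e'.frame (N + 1) (by omega)
  refine ⟨1 + (t' + (1 + (1 + (u' + 1)))), by omega, _, .seq (.copy _ _ _) (.seq e
    (.seq (.copy _ _ _) (.seq (.copy _ _ _) (.seq e' (.cons _ _ _ _))))), ?_⟩
  simp [f₂, hυ, hτ]

/-- If the value of `c` is not `nil`, the value of `p`, otherwise that of `q`. -/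
def condP (c p q : WhileProg) : WhileProg :=
  let N := max c.bound (max p.bound q.bound)
  .seq (.copy N 0) (.seq c (.seq (.copy (N + 1) 0) (.seq (.copy 0 N) (.ite (N + 1) p q))))

theorem Ev.cond_true {c p q : WhileProg} {x y z : SExp} {t u : ℕ} (hc : Ev c x t y)
    (hy : y ≠ .nil) (hp : Ev p x u z) : Ev (condP c p q) x (t + u + 4) z := by
  intro σ hσ
  have hN₁ : c.bound ≤ max c.bound (max p.bound q.bound) := le_max_left _ _
  have hN₀ := c.bound_pos
  unfold condP
  generalize max c.bound (max p.bound q.bound) = N at hN₁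
  obtain ⟨t', ht', τ, e, hτ⟩ := hc (Function.update σ N (σ 0))
    (by simp [Function.update_apply, hσ])
  have f₁ := e.frame N hN₁
  obtain ⟨u', hu', υ, e', hυ⟩ := hp
    (Function.update (Function.update τ (N + 1) (τ 0)) 0
      (Function.update τ (N + 1) (τ 0) N))
    (by simp [hσ, f₁])
  exact ⟨1 + (t' + (1 + (1 + (u' + 1)))), by omega, υ, .seq (.copy _ _ _) (.seq e
    (.seq (.copy _ _ _) (.seq (.copy _ _ _) (.ite_true (by simpa [hτ] using hy) e')))), hυ⟩

theorem Ev.cond_false {c p q : WhileProg} {x z : SExp} {t u : ℕ} (hc : Ev c x t .nil)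
    (hq : Ev q x u z) : Ev (condP c p q) x (t + u + 4) z := by
  intro σ hσ
  have hN₁ : c.bound ≤ max c.bound (max p.bound q.bound) := le_max_left _ _
  have hN₀ := c.bound_pos
  unfold condP
  generalize max c.bound (max p.bound q.bound) = N at hN₁
  obtain ⟨t', ht', τ, e, hτ⟩ := hc (Function.update σ N (σ 0))
    (by simp [Function.update_apply, hσ])
  have f₁ := e.frame N hN₁
  obtain ⟨u', hu', υ, e', hυ⟩ := hq
    (Function.update (Function.update τ (N + 1) (τ 0)) 0
      (Function.update τ (N + 1) (τ 0) N))
    (by simp [hσ, f₁])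
  exact ⟨1 + (t' + (1 + (1 + (u' + 1)))), by omega, υ, .seq (.copy _ _ _) (.seq e
    (.seq (.copy _ _ _) (.seq (.copy _ _ _) (.ite_false (by simp [hτ]) e')))), hυ⟩

theorem Ev.cond {c p q : WhileProg} {x z : SExp} {b : Bool} {t u : ℕ}
    (hc : Ev c x t (.ofBool b)) (hp : b = true → Ev p x u z) (hq : b = false → Ev q x u z) :
    Ev (condP c p q) x (t + u + 4) z := by
  cases b with
  | true => exact Ev.cond_true hc (by simp [SExp.ofBool]) (hp rfl)
  | false => exact Ev.cond_false hc (hq rfl)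

/-- The reversed list of the pairs of corresponding entries of two lists, given as a pair; the
second list is padded with `nil`. -/
def revZipP : WhileProg :=
  .seq (.head 1 0) (.seq (.tail 2 0) (.seq (.setNil 0) (.loop 1
    (.seq (.head 3 1) (.seq (.head 4 2) (.seq (.cons 3 3 4) (.seq (.cons 0 3 0)
      (.seq (.tail 1 1) (.tail 2 2)))))))))

/-- The entries of `l` paired with those of the list `b`, which is padded with `nil`. -/
def zipPad : List SExp → SExp → List SExp
  | [], _ => []
  | a :: l, b => .cons a b.head :: zipPad l b.tail

theorem Ev.revZip (l : List SExp) (b : SExp) :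
    Ev revZipP (.cons (.ofList l) b) (7 * l.length + 4) (.ofList (zipPad l b).reverse) := by
  have key : ∀ (l : List SExp) (σ : Store) (b : SExp) (l' : List SExp), σ 1 = .ofList l →
      σ 2 = b → σ 0 = .ofList l' → ∃ τ, Exec (.loop 1
        (.seq (.head 3 1) (.seq (.head 4 2) (.seq (.cons 3 3 4) (.seq (.cons 0 3 0)
          (.seq (.tail 1 1) (.tail 2 2))))))) σ (7 * l.length + 1) τ ∧
      τ 0 = .ofList ((zipPad l b).reverse ++ l') := by
    intro l
    induction l with
    | nil => exact fun σ b l' h₁ h₂ h₃ => ⟨σ, .loop_exit h₁, h₃⟩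
    | cons a l ih =>
      intro σ b l' h₁ h₂ h₃
      let σ₁ := Function.update σ 3 (σ 1).head
      let σ₂ := Function.update σ₁ 4 (σ₁ 2).head
      let σ₃ := Function.update σ₂ 3 (.cons (σ₂ 3) (σ₂ 4))
      let σ₄ := Function.update σ₃ 0 (.cons (σ₃ 3) (σ₃ 0))
      let σ₅ := Function.update σ₄ 1 (σ₄ 1).tail
      obtain ⟨τ, e, hτ⟩ := ih (Function.update σ₅ 2 (σ₅ 2).tail) b.tail (.cons a b.head :: l')
        (by simp [σ₁, σ₂, σ₃, σ₄, σ₅, h₁, SExp.ofList, SExp.tail])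
        (by simp [σ₁, σ₂, σ₃, σ₄, σ₅, h₂])
        (by simp [σ₁, σ₂, σ₃, σ₄, σ₅, h₁, h₂, h₃, SExp.ofList, SExp.head])
      refine ⟨τ, ?_, by simpa [zipPad] using hτ⟩
      rw [show 7 * (a :: l).length + 1 = 6 + (7 * l.length + 1) + 1 by
        simp only [List.length_cons]; ring]
      exact .loop_iter (by simp [h₁, SExp.ofList])
        (.seq (.head _ _ _) (.seq (.head _ _ _) (.seq (.cons _ _ _ _) (.seq (.cons _ _ _ _)
          (.seq (.tail _ _ _) (.tail _ _ _)))))) e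
  intro σ hσ
  obtain ⟨τ, e, hτ⟩ := key l (Function.update (Function.update (Function.update σ 1 (σ 0).head) 2
    (Function.update σ 1 (σ 0).head 0).tail) 0 .nil) b [] (by simp [hσ, SExp.head])
    (by simp [hσ, SExp.tail]) (by simp [SExp.ofList])
  exact ⟨1 + (1 + (1 + (7 * l.length + 1))), by omega, τ, .seq (.head _ _ _) (.seq (.tail _ _ _)
    (.seq (.setNil _ _) e)), by simpa using hτ⟩

/-- Starting from the value of `ini`, apply `body` once for each entry `a` of the value of `lst`;
the input of `body` is the entry, the current value, and the input `x` of the whole program, in a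
list. -/
def foldlP (lst ini body : WhileProg) : WhileProg :=
  let N := max lst.bound (max ini.bound body.bound)
  .seq (.copy N 0) (.seq lst (.seq (.copy (N + 1) 0) (.seq (.copy 0 N) (.seq ini (.loop (N + 1)
    (.seq (.cons 0 0 N) (.seq (.head (N + 2) (N + 1)) (.seq (.cons 0 (N + 2) 0)
      (.seq (.tail (N + 1) (N + 1)) body)))))))))

theorem Ev.foldl {lst ini body : WhileProg} {x : SExp} {t₁ t₂ t : ℕ} {l : List SExp}
    (acc : List SExp → SExp)
    (hl : Ev lst x t₁ (.ofList l.reverse)) (hi : Ev ini x t₂ (acc []))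
    (hb : ∀ a l', (a :: l') <:+ l → Ev body (.cons a (.cons (acc l') x)) t (acc (a :: l'))) :
    Ev (foldlP lst ini body) x (t₁ + t₂ + l.length * (t + 5) + 4) (acc l) := by
  intro σ hσ
  have hN₁ : lst.bound ≤ max lst.bound (max ini.bound body.bound) := le_max_left _ _
  have hN₂ : ini.bound ≤ max lst.bound (max ini.bound body.bound) := by simp
  have hN₃ : body.bound ≤ max lst.bound (max ini.bound body.bound) := by simp
  have hN₀ := lst.bound_pos
  unfold foldlP
  generalize max lst.bound (max ini.bound body.bound) = N at hN₁ hN₂ hN₃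
  -- The entries in `l₂` have been processed, those in `l₁` have not.
  have key : ∀ (l₁ l₂ : List SExp) (σ : Store), l₁.reverse ++ l₂ = l → σ N = x →
      σ (N + 1) = .ofList l₁ → σ 0 = acc l₂ → ∃ t' ≤ l₁.length * (t + 5) + 1, ∃ τ,
      Exec (.loop (N + 1) (.seq (.cons 0 0 N) (.seq (.head (N + 2) (N + 1))
        (.seq (.cons 0 (N + 2) 0) (.seq (.tail (N + 1) (N + 1)) body))))) σ t' τ ∧
      τ 0 = acc l := by
    intro l₁
    induction l₁ with
    | nil =>
      intro l₂ σ h h₁ h₂ h₃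
      exact ⟨1, by omega, σ, .loop_exit h₂, by simpa [← h] using h₃⟩
    | cons a l₁ ih =>
      intro l₂ σ h h₁ h₂ h₃
      have hsuf : (a :: l₂) <:+ l := ⟨l₁.reverse, by simpa using h⟩
      let σ₁ := Function.update σ 0 (.cons (σ 0) (σ N))
      let σ₂ := Function.update σ₁ (N + 2) (σ₁ (N + 1)).head
      let σ₃ := Function.update σ₂ 0 (.cons (σ₂ (N + 2)) (σ₂ 0))
      let σ₄ := Function.update σ₃ (N + 1) (σ₃ (N + 1)).tail
      obtain ⟨u, hu, τ, e, hτ⟩ := hb a l₂ hsuf σ₄ (by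
        simp [σ₁, σ₂, σ₃, σ₄, h₁, h₂, h₃, SExp.ofList, SExp.head])
      have f₁ := e.frame N hN₃
      have f₂ := e.frame (N + 1) (by omega)
      obtain ⟨v, hv, υ, e', hυ⟩ := ih (a :: l₂) τ (by simpa using h)
        (by
          have : N ≠ 0 := by omega
          simp [f₁, σ₁, σ₂, σ₃, σ₄, h₁, this])
        (by simp [f₂, σ₁, σ₂, σ₃, σ₄, h₂, SExp.ofList, SExp.tail]) hτ
      refine ⟨1 + (1 + (1 + (1 + u))) + v + 1, ?_, υ, .loop_iter (by simp [h₂, SExp.ofList])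
        (.seq (.cons _ _ _ _) (.seq (.head _ _ _) (.seq (.cons _ _ _ _)
          (.seq (.tail _ _ _) e)))) e', hυ⟩
      simp only [List.length_cons, add_mul, one_mul]
      omega
  obtain ⟨u₁, hu₁, τ₁, e₁, hτ₁⟩ := hl (Function.update σ N (σ 0))
    (by simp [Function.update_apply, hσ])
  have f₁ := e₁.frame N hN₁
  have hN : N ≠ 0 := by omega
  obtain ⟨u₂, hu₂, τ₂, e₂, hτ₂⟩ := hi
    (Function.update (Function.update τ₁ (N + 1) (τ₁ 0)) 0
      (Function.update τ₁ (N + 1) (τ₁ 0) N))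
    (by simp [hσ, f₁])
  have g₁ := e₂.frame N hN₂
  have g₂ := e₂.frame (N + 1) (by omega)
  obtain ⟨u₃, hu₃, τ₃, e₃, hτ₃⟩ := key l.reverse [] τ₂ (by simp)
    (by simp [g₁, f₁, hN, hσ]) (by simp [g₂, hτ₁]) hτ₂
  refine ⟨1 + (u₁ + (1 + (1 + (u₂ + u₃)))), ?_, τ₃, .seq (.copy _ _ _) (.seq e₁
    (.seq (.copy _ _ _) (.seq (.copy _ _ _) (.seq e₂ e₃)))), hτ₃⟩
  rw [List.length_reverse] at hu₃
  omega

/-- Right fold over the pairs of corresponding entries of the lists `la` and `lb`. The input of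
`body` is the list of the pair, the current value, and the entries of the input of the whole
program. -/
def foldrP (la lb ini body : WhileProg) : WhileProg :=
  foldlP (compP revZipP (pairP la lb)) ini body

theorem zipPad_map {α : Type*} (L : List α) (fa fb : α → SExp) :
    zipPad (L.map fa) (.ofList (L.map fb)) = L.map fun v => .cons (fa v) (fb v) := by
  induction L with
  | nil => rfl
  | cons a L ih => simpa [zipPad, SExp.ofList, SExp.head, SExp.tail] using ih

theorem zipPad_nil {α : Type*} (L : List α) (fa : α → SExp) :
    zipPad (L.map fa) .nil = L.map fun v => .cons (fa v) .nil := by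
  induction L with
  | nil => rfl
  | cons a L ih => simpa [zipPad, SExp.head, SExp.tail] using ih

/-- The rule for right folds, in terms of encodings `fa`, `fb` and `enc` of abstract data. The
bound for the running time of `body` may use that only folds over suffixes of the list occur. -/
theorem Ev.foldr_suffix {α β : Type*} {la lb ini body : WhileProg} {x b : SExp}
    {t₁ t₂ t₃ t : ℕ} {fa fb : α → SExp} (enc : β → SExp) {L : List α} {b₀ : β}
    (g : α → β → β) (ha : Ev la x t₁ (.ofList (L.map fa))) (hb : Ev lb x t₂ b)
    (hzip : zipPad (L.map fa) b = L.map fun v => .cons (fa v) (fb v))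
    (hi : Ev ini x t₃ (enc b₀))
    (h : ∀ v L', (v :: L') <:+ L → Ev body (.cons (.cons (fa v) (fb v))
      (.cons (enc (L'.foldr g b₀)) x)) t (enc ((v :: L').foldr g b₀))) :
    Ev (foldrP la lb ini body) x (t₁ + t₂ + t₃ + L.length * (t + 12) + 12)
      (enc (L.foldr g b₀)) := by
  have h₁ := (Ev.revZip (L.map fa) b).comp (ha.pair hb)
  rw [hzip] at h₁
  suffices ∀ M, M <:+ L → ∀ (lst : WhileProg) (u : ℕ), Ev lst x u (.ofList (M.map fun v =>
      SExp.cons (fa v) (fb v)).reverse) →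
      Ev (foldlP lst ini body) x (u + t₃ + M.length * (t + 5) + 4) (enc (M.foldr g b₀)) by
    refine (this L (List.suffix_refl L) _ _ h₁).mono ?_
    simp only [List.length_map]
    nlinarith
  intro M hM lst u hlst
  -- The value reached after a list of pairs is recovered from its length, which determines the
  -- suffix of `M` it stems from.
  have hdrop : ∀ a l', (a :: l') <:+ M.map (fun v => SExp.cons (fa v) (fb v)) → ∃ v L',
      (v :: L') <:+ M ∧ a = .cons (fa v) (fb v) ∧ l'.length = L'.length := by
    rintro a l' ⟨l₁, hl₁⟩
    obtain ⟨M₁, M₂, rfl, -, h₂⟩ := List.map_eq_append_iff.1 hl₁.symm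
    obtain ⟨v, L', rfl, h₃, h₄⟩ := List.map_eq_cons_iff.1 h₂
    exact ⟨v, L', List.suffix_append _ _, h₃.symm, by simp [← h₄]⟩
  have hlen : ∀ L', L' <:+ M → M.drop (M.length - L'.length) = L' := by
    rintro L' ⟨l₁, rfl⟩
    simp
  have := Ev.foldl (x := x) (body := body) (t := t)
    (fun l' => enc ((M.drop (M.length - l'.length)).foldr g b₀)) hlst (by simpa using hi) (by
      intro a l' hal
      obtain ⟨v, L', hs, rfl, hl⟩ := hdrop a l' hal
      have h₂ := h v L' (hs.trans hM)
      have e₁ := hlen _ hs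
      have e₂ := hlen _ ((List.suffix_cons v L').trans hs)
      simp only [List.length_cons] at e₁
      simpa only [List.length_cons, hl, e₁, e₂] using h₂)
  simpa using this

/-- Right fold over one list; see `Ev.foldr_suffix`. -/
theorem Ev.foldr_one {α β : Type*} {la ini body : WhileProg} {x : SExp}
    {t₁ t₃ t : ℕ} {fa : α → SExp} (enc : β → SExp) {L : List α} {b₀ : β}
    (g : α → β → β) (ha : Ev la x t₁ (.ofList (L.map fa))) (hi : Ev ini x t₃ (enc b₀))
    (h : ∀ v b, Ev body (.cons (.cons (fa v) .nil) (.cons (enc b) x)) t (enc (g v b))) :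
    Ev (foldrP la nilP ini body) x (t₁ + t₃ + L.length * (t + 12) + 13)
      (enc (L.foldr g b₀)) :=
  (Ev.foldr_suffix (fb := fun _ => .nil) enc g ha Ev.nil (zipPad_nil L fa) hi
    fun v _ _ => h v _).mono (by omega)

/-- Right fold over two lists; see `Ev.foldr_suffix`. -/
theorem Ev.foldr_two {α β : Type*} {la lb ini body : WhileProg} {x : SExp}
    {t₁ t₂ t₃ t : ℕ} {fa fb : α → SExp} (enc : β → SExp) {L : List α} {b₀ : β}
    (g : α → β → β) (ha : Ev la x t₁ (.ofList (L.map fa)))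
    (hb : Ev lb x t₂ (.ofList (L.map fb))) (hi : Ev ini x t₃ (enc b₀))
    (h : ∀ v b, Ev body (.cons (.cons (fa v) (fb v)) (.cons (enc b) x)) t (enc (g v b))) :
    Ev (foldrP la lb ini body) x (t₁ + t₂ + t₃ + L.length * (t + 12) + 12)
      (enc (L.foldr g b₀)) :=
  Ev.foldr_suffix enc g ha hb (zipPad_map L fa fb) hi fun v _ _ => h v _

/-- Starting from the value of `ini`, apply `body` as long as the first component of the current
value is not `nil`. The input of `body` is the pair of the current value and the input of the
whole program. -/
def whileP (ini body : WhileProg) : WhileProg :=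
  let N := max ini.bound body.bound
  .seq (.copy N 0) (.seq ini (.seq (.head (N + 1) 0) (.loop (N + 1)
    (.seq (.cons 0 0 N) (.seq body (.head (N + 1) 0))))))

/-- Total correctness of loops: `μ` is a variant, `Inv` an invariant. -/
theorem Ev.while {α : Type*} {ini body : WhileProg} {x : SExp} {t₁ t : ℕ} (enc : α → SExp)
    (Inv : α → Prop) (μ : α → ℕ) {a₀ : α} (hi : Ev ini x t₁ (enc a₀)) (h₀ : Inv a₀)
    (hb : ∀ a, Inv a → (enc a).head ≠ .nil → ∃ a', Ev body (.cons (enc a) x) t (enc a') ∧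
      Inv a' ∧ μ a' < μ a) :
    ∃ a, Ev (whileP ini body) x (t₁ + μ a₀ * (t + 3) + 3) (enc a) ∧ Inv a ∧
      (enc a).head = .nil := by
  have hN₁ : ini.bound ≤ max ini.bound body.bound := le_max_left _ _
  have hN₂ : body.bound ≤ max ini.bound body.bound := le_max_right _ _
  have hN₀ := ini.bound_pos
  unfold whileP
  generalize max ini.bound body.bound = N at hN₁ hN₂
  have hN : N ≠ 0 := by omega
  have key : ∀ (k : ℕ) (a : α), μ a ≤ k → Inv a → ∃ a', (Inv a' ∧ (enc a').head = .nil) ∧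
      ∀ σ : Store, σ N = x → σ 0 = enc a → σ (N + 1) = (enc a).head →
      ∃ t' ≤ k * (t + 3) + 1, ∃ τ, Exec (.loop (N + 1)
        (.seq (.cons 0 0 N) (.seq body (.head (N + 1) 0)))) σ t' τ ∧ τ 0 = enc a' := by
    intro k
    induction k with
    | zero =>
      intro a hk ha
      by_cases hn : (enc a).head = .nil
      · exact ⟨a, ⟨ha, hn⟩, fun σ _ h₂ h₃ =>
          ⟨1, by omega, σ, .loop_exit (h₃.trans hn), h₂⟩⟩
      · obtain ⟨a', -, -, h⟩ := hb a ha hn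
        omega
    | succ k ih =>
      intro a hk ha
      by_cases hn : (enc a).head = .nil
      · exact ⟨a, ⟨ha, hn⟩, fun σ _ h₂ h₃ =>
          ⟨1, by omega, σ, .loop_exit (h₃.trans hn), h₂⟩⟩
      · obtain ⟨a₁, e₁, ha₁, hμ⟩ := hb a ha hn
        obtain ⟨a', ha', H⟩ := ih a₁ (by omega) ha₁
        refine ⟨a', ha', fun σ s₁ s₂ s₃ => ?_⟩
        obtain ⟨u, hu, τ, e, hτ⟩ := e₁ (Function.update σ 0 (.cons (σ 0) (σ N)))
          (by simp [s₁, s₂])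
        have f₁ := e.frame N hN₂
        obtain ⟨v, hv, υ, e', hυ⟩ := H (Function.update τ (N + 1) (τ 0).head)
          (by simp [f₁, hN, s₁]) (by simp [hτ]) (by simp [hτ])
        refine ⟨1 + (u + 1) + v + 1, ?_, υ, .loop_iter (by rwa [s₃]) (.seq (.cons _ _ _ _)
          (.seq e (.head _ _ _))) e', hυ⟩
        simp only [add_mul, one_mul] at hv ⊢
        omega
  obtain ⟨a, ha, H⟩ := key (μ a₀) a₀ le_rfl h₀
  refine ⟨a, fun σ hσ => ?_, ha⟩
  obtain ⟨u, hu, τ, e, hτ⟩ := hi (Function.update σ N (σ 0))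
    (by simp [Function.update_apply, hσ])
  have f₁ := e.frame N hN₁
  obtain ⟨v, hv, υ, e', hυ⟩ := H (Function.update τ (N + 1) (τ 0).head)
    (by simp [f₁, hσ]) (by simp [hτ]) (by simp [hτ])
  exact ⟨1 + (u + (1 + v)), by omega, υ, .seq (.copy _ _ _) (.seq e (.seq (.head _ _ _) e')), hυ⟩

/-- Set the variables `1, …, n` to `nil`. -/
def clearP : ℕ → WhileProg
  | 0 => .copy 0 0
  | n + 1 => .seq (clearP n) (.setNil (n + 1))

theorem exec_clearP (n : ℕ) (σ : Store) :
    Exec (clearP n) σ (n + 1) fun v => if 1 ≤ v ∧ v ≤ n then .nil else σ v := by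
  induction n with
  | zero =>
    have h : (fun v => if 1 ≤ v ∧ v ≤ 0 then SExp.nil else σ v) =
        Function.update σ 0 (σ 0) := by
      funext v
      rw [if_neg (by omega), Function.update_eq_self]
    rw [h]
    exact .copy 0 0 σ
  | succ n ih =>
    have h : (fun v => if 1 ≤ v ∧ v ≤ n + 1 then SExp.nil else σ v) = Function.update
        (fun v => if 1 ≤ v ∧ v ≤ n then SExp.nil else σ v) (n + 1) .nil := by
      funext v
      by_cases h : v = n + 1
      · simp [h]
      · rw [Function.update_of_ne h]
        congr 1
        simp only [eq_iff_iff]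
        omega
    rw [h]
    exact ih.seq (.setNil (n + 1) _)

/-- Run a decision procedure as a subroutine: clear all variables but the input, and normalise the
answer to a truth value. -/
def runP (p : WhileProg) : WhileProg :=
  .seq (.seq (clearP p.bound) p) (.ite 0 (.seq (.setNil 0) (.cons 0 0 0)) (.setNil 0))

open Classical in
theorem Ev.run {p : WhileProg} {x : SExp} {t : ℕ} {τ : Store} (h : Exec p (initStore x) t τ) :
    Ev (runP p) x (t + p.bound + 4) (.ofBool (decide (τ 0 ≠ .nil))) := by
  intro σ hσ
  obtain ⟨τ', e, hτ'⟩ := h.congr (N := p.bound) le_rfl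
    (fun v => if 1 ≤ v ∧ v ≤ p.bound then .nil else σ v) (by
      intro v hv
      by_cases h0 : v = 0
      · simp [h0, initStore, hσ]
      · rw [if_pos (by omega)]
        simp [initStore, Function.update_of_ne h0])
  have h0 := hτ' 0 p.bound_pos
  have e' := Exec.seq (exec_clearP p.bound σ) e
  by_cases hn : τ 0 = .nil
  · refine ⟨_, ?_, _, .seq e' (.ite_false (h0.trans hn) (.setNil 0 τ')), ?_⟩
    · omega
    · simp [hn, SExp.ofBool]
  · refine ⟨_, ?_, _, .seq e' (.ite_true (by rwa [h0]) (.seq (.setNil 0 τ') (.cons 0 0 0 _))), ?_⟩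
    · omega
    · simp [hn, SExp.ofBool]

end WhileProg

/-! ### The bounded search tree -/

section Search

variable {m : ℕ} {ω : Type}

/-- Some subset of `U` satisfies `P`. This is the information that a decision procedure yields. -/
def Feasible (P : Finset (Fin m) → Prop) (U : Finset (Fin m)) : Prop := ∃ T ⊆ U, P T

theorem Feasible.mono {P : Finset (Fin m) → Prop} {U U' : Finset (Fin m)} (h : Feasible P U)
    (hU : U ⊆ U') : Feasible P U' :=
  let ⟨T, hT, hP⟩ := h
  ⟨T, hT.trans hU, hP⟩

open Classical in
/-- Delete the vertices of `L` from `U`, one after the other, as long as the remaining set stays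
feasible. -/
noncomputable def shrink (P : Finset (Fin m) → Prop) (L : List (Fin m)) (U : Finset (Fin m)) :
    Finset (Fin m) :=
  L.foldr (fun v A => if Feasible P (A \ {v}) then A \ {v} else A) U

theorem shrink_subset (P : Finset (Fin m) → Prop) (L : List (Fin m)) (U : Finset (Fin m)) :
    shrink P L U ⊆ U := by
  induction L with
  | nil => exact subset_rfl
  | cons v L ih =>
    simp only [shrink, List.foldr_cons] at ih ⊢
    split_ifs
    · exact Finset.sdiff_subset.trans ih
    · exact ih

theorem feasible_shrink {P : Finset (Fin m) → Prop} {U : Finset (Fin m)} (h : Feasible P U)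
    (L : List (Fin m)) : Feasible P (shrink P L U) := by
  induction L with
  | nil => exact h
  | cons v L ih =>
    simp only [shrink, List.foldr_cons] at ih ⊢
    split_ifs with h'
    · exact h'
    · exact ih

theorem not_feasible_shrink_sdiff {P : Finset (Fin m) → Prop} {U : Finset (Fin m)}
    {L : List (Fin m)} {v : Fin m} (hv : v ∈ L) (hv' : v ∈ shrink P L U) :
    ¬ Feasible P (shrink P L U \ {v}) := by
  induction L with
  | nil => simp at hv
  | cons x L ih =>
    simp only [shrink, List.foldr_cons] at ih hv' ⊢
    split_ifs at hv' ⊢ with h'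
    · have hx : v ≠ x := by
        rintro rfl
        simp at hv'
      exact fun h => ih ((List.mem_cons.1 hv).resolve_left hx) (Finset.sdiff_subset hv')
        (h.mono (Finset.sdiff_subset_sdiff Finset.sdiff_subset subset_rfl))
    · rcases List.mem_cons.1 hv with rfl | hv
      · exact h'
      · exact ih hv hv'

/-- Self-reducibility: if no single vertex can be deleted, the remaining set is a solution. -/
theorem shrink_spec {P : Finset (Fin m) → Prop} {U : Finset (Fin m)} (h : Feasible P U) :
    P (shrink P (List.finRange m) U) := by
  obtain ⟨T, hT, hP⟩ := feasible_shrink h (List.finRange m)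
  convert hP
  refine subset_antisymm (fun v hv => ?_) hT
  by_contra hvT
  exact not_feasible_shrink_sdiff (List.mem_finRange v) hv
    ⟨T, fun x hx => by
      simp only [Finset.mem_sdiff, Finset.mem_singleton]
      exact ⟨hT hx, fun e => hvT (e ▸ hx)⟩, hP⟩

open Classical in
/-- Starting from the set `U`, find a minimal solution and delete its vertices outside `R`, `K`
times or as long as there is a solution. The Boolean says whether all rounds were successful, the
set consists of the remaining vertices. -/
noncomputable def pack (P : Finset (Fin m) → Prop) (R : Finset (Fin m)) (K : ℕ)
    (U : Finset (Fin m)) : Bool × Finset (Fin m) :=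
  (List.replicate K ()).foldr (fun _ A => if Feasible P A.2
    then (true, A.2 \ (shrink P (List.finRange m) A.2 \ R)) else (false, A.2)) (true, U)

theorem pack_zero (P : Finset (Fin m) → Prop) (R U : Finset (Fin m)) :
    pack P R 0 U = (true, U) := rfl

theorem pack_succ_of_feasible {P : Finset (Fin m) → Prop} {R U : Finset (Fin m)} {K : ℕ}
    (h : Feasible P (pack P R K U).2) : pack P R (K + 1) U =
      (true, (pack P R K U).2 \ (shrink P (List.finRange m) (pack P R K U).2 \ R)) :=
  if_pos h

theorem pack_succ_of_not_feasible {P : Finset (Fin m) → Prop} {R U : Finset (Fin m)} {K : ℕ}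
    (h : ¬ Feasible P (pack P R K U).2) :
    pack P R (K + 1) U = (false, (pack P R K U).2) :=
  if_neg h

theorem pack_subset (P : Finset (Fin m) → Prop) (R : Finset (Fin m)) (K : ℕ)
    (U : Finset (Fin m)) : (pack P R K U).2 ⊆ U := by
  induction K with
  | zero => exact subset_rfl
  | succ K ih =>
    by_cases h : Feasible P (pack P R K U).2
    · rw [pack_succ_of_feasible h]
      exact Finset.sdiff_subset.trans ih
    · rwa [pack_succ_of_not_feasible h]

theorem disjoint_sdiff_pack (P : Finset (Fin m) → Prop) (R : Finset (Fin m)) (K : ℕ)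
    (U : Finset (Fin m)) : Disjoint (U \ (pack P R K U).2) R := by
  induction K with
  | zero => simp [pack_zero]
  | succ K ih =>
    by_cases h : Feasible P (pack P R K U).2
    · rw [pack_succ_of_feasible h]
      rw [Finset.disjoint_left] at ih ⊢
      intro x hx hxR
      have := ih (a := x)
      simp only [Finset.mem_sdiff] at hx this
      tauto
    · rwa [pack_succ_of_not_feasible h]

theorem card_sdiff_pack {P : Finset (Fin m) → Prop} {s : ℕ} (hs : ∀ T, P T → T.card ≤ s)
    (R : Finset (Fin m)) (K : ℕ) (U : Finset (Fin m)) :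
    (U \ (pack P R K U).2).card ≤ K * s := by
  induction K with
  | zero => simp [pack_zero]
  | succ K ih =>
    by_cases h : Feasible P (pack P R K U).2
    · rw [pack_succ_of_feasible h]
      calc _ ≤ ((U \ (pack P R K U).2) ∪ shrink P (List.finRange m) (pack P R K U).2).card := by
            refine Finset.card_le_card fun x hx => ?_
            simp only [Finset.mem_sdiff, Finset.mem_union] at hx ⊢
            tauto
        _ ≤ K * s + s := (Finset.card_union_le _ _).trans
            (Nat.add_le_add ih (hs _ (shrink_spec h)))
        _ = (K + 1) * s := by ring
    · rw [pack_succ_of_not_feasible h]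
      exact ih.trans (Nat.mul_le_mul_right _ K.le_succ)

theorem pack_fst_of_not_feasible {P : Finset (Fin m) → Prop} {R U : Finset (Fin m)} {K : ℕ}
    (h : (pack P R K U).1 = false) : ¬ Feasible P (pack P R K U).2 := by
  cases K with
  | zero => simp [pack_zero] at h
  | succ K =>
    by_cases h' : Feasible P (pack P R K U).2
    · simp [pack_succ_of_feasible h'] at h
    · rwa [pack_succ_of_not_feasible h']

theorem pack_fst_succ {P : Finset (Fin m) → Prop} {R U : Finset (Fin m)} {K : ℕ}
    (h : (pack P R (K + 1) U).1 = true) : Feasible P (pack P R K U).2 := by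
  by_contra h'
  simp [pack_succ_of_not_feasible h'] at h

/-- If all rounds were successful, the solutions found are disjoint outside `R`. Hence a set of
less than `K` vertices that avoids `R` cannot meet all of them. -/
theorem exists_disjoint_of_pack {P : Finset (Fin m) → Prop} {R U W : Finset (Fin m)} {K : ℕ}
    (h : (pack P R K U).1 = true) (hR : Disjoint W R) (hW : W.card < K) :
    ∃ T ⊆ U, P T ∧ Disjoint T W := by
  suffices (∃ T ⊆ U, P T ∧ Disjoint T W) ∨ K ≤ (W ∩ (U \ (pack P R K U).2)).card by
    refine this.resolve_right fun h' => ?_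
    have := Finset.card_le_card (Finset.inter_subset_left : W ∩ (U \ (pack P R K U).2) ⊆ W)
    omega
  clear hW
  induction K with
  | zero => simp
  | succ K ih =>
    have hf := pack_fst_succ h
    have h₁ : (pack P R K U).1 = true := by
      by_contra h₁
      exact pack_fst_of_not_feasible (by simpa using h₁) hf
    refine (ih h₁).elim Or.inl fun hK => ?_
    have hM := shrink_spec hf
    have hMU := shrink_subset P (List.finRange m) (pack P R K U).2
    have hU := pack_subset P R K U
    rw [pack_succ_of_feasible hf]
    generalize shrink P (List.finRange m) (pack P R K U).2 = M at hM hMU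
    generalize (pack P R K U).2 = A at *
    by_cases hd : Disjoint M W
    · exact .inl ⟨M, hMU.trans hU, hM, hd⟩
    right
    obtain ⟨x, hxM, hxW⟩ := Finset.not_disjoint_iff.1 hd
    have hxR : x ∉ R := Finset.disjoint_left.1 hR hxW
    refine Nat.succ_le_of_lt (hK.trans_lt (Finset.card_lt_card ⟨fun y hy => ?_, fun hsub => ?_⟩))
    · simp only [Finset.mem_inter, Finset.mem_sdiff] at hy ⊢
      tauto
    · have h₁ := hMU hxM
      have h₂ := hU h₁
      have := hsub (x := x)
      simp only [Finset.mem_inter, Finset.mem_sdiff] at this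
      tauto

/-- The agents of the list can be served with pairwise disjoint bundles contained in `F`. -/
def Allocatable (good : ω → Finset (Fin m) → Prop) : List ω → Finset (Fin m) → Prop
  | [], _ => True
  | a :: as, F => ∃ T ⊆ F, good a T ∧ Allocatable good as (F \ T)

theorem Allocatable.mono {good : ω → Finset (Fin m) → Prop} {as : List ω}
    {F F' : Finset (Fin m)} (h : Allocatable good as F) (hF : F ⊆ F') :
    Allocatable good as F' := by
  induction as generalizing F F' with
  | nil => trivial
  | cons a as ih =>
    obtain ⟨T, hT, hg, h⟩ := h
    exact ⟨T, hT.trans hF, hg, ih h (Finset.sdiff_subset_sdiff hF subset_rfl)⟩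

theorem Allocatable.exists_small {good : ω → Finset (Fin m) → Prop} {s : ℕ}
    (hs : ∀ a T, good a T → T.card ≤ s) {as : List ω} {F : Finset (Fin m)}
    (h : Allocatable good as F) :
    ∃ W ⊆ F, W.card ≤ as.length * s ∧ Allocatable good as W := by
  induction as generalizing F with
  | nil => exact ⟨∅, by simp, by simp, trivial⟩
  | cons a as ih =>
    obtain ⟨T, hT, hg, h⟩ := h
    obtain ⟨W, hW, hc, hA⟩ := ih h
    refine ⟨T ∪ W, Finset.union_subset hT (hW.trans Finset.sdiff_subset), ?_, T,
      Finset.subset_union_left, hg, hA.mono fun x hx => ?_⟩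
    · have := Finset.card_union_le T W
      have := hs a T hg
      simp only [List.length_cons, add_mul, one_mul]
      omega
    · have := hW hx
      simp only [Finset.mem_sdiff, Finset.mem_union] at this ⊢
      tauto

/-- The agents given by a family can be served from `F` if and only if there are pairwise disjoint
bundles contained in `F`. -/
theorem allocatable_ofFn {good : ω → Finset (Fin m) → Prop} {n : ℕ} {u : Fin n → ω}
    {F : Finset (Fin m)} : Allocatable good (List.ofFn u) F ↔
      ∃ φ : Fin n → Finset (Fin m), (∀ a, φ a ⊆ F ∧ good (u a) (φ a)) ∧
        ∀ a b, a ≠ b → Disjoint (φ a) (φ b) := by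
  induction n generalizing F with
  | zero => simp [Allocatable]
  | succ n ih =>
    rw [List.ofFn_succ, Allocatable]
    constructor
    · rintro ⟨T, hT, hg, h⟩
      obtain ⟨φ, h₁, h₂⟩ := ih.1 h
      have hd : ∀ a, Disjoint T (φ a) := fun a =>
        Finset.disjoint_of_subset_right (h₁ a).1 Finset.disjoint_sdiff
      refine ⟨Fin.cons T φ, fun a => ?_, fun a b => ?_⟩
      · cases a using Fin.cases with
        | zero => exact ⟨hT, hg⟩
        | succ a => exact ⟨(h₁ a).1.trans Finset.sdiff_subset, (h₁ a).2⟩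
      · cases a using Fin.cases with
        | zero =>
          cases b using Fin.cases with
          | zero => exact fun h => absurd rfl h
          | succ b => exact fun _ => hd b
        | succ a =>
          cases b using Fin.cases with
          | zero => exact fun _ => (hd a).symm
          | succ b => exact fun h => h₂ a b fun e => h (congrArg Fin.succ e)
    · rintro ⟨φ, h₁, h₂⟩
      refine ⟨φ 0, (h₁ 0).1, (h₁ 0).2, ih.2 ⟨fun a => φ a.succ, fun a => ⟨?_, (h₁ _).2⟩,
        fun a b hab => h₂ _ _ fun e => hab (Fin.succ_injective _ e)⟩⟩
      exact Finset.subset_sdiff.2 ⟨(h₁ _).1, h₂ _ _ (Fin.succ_ne_zero a)⟩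

/-- A node of the search tree. The vertices of `free` may be given to every remaining agent, those
of `allowed \ free` have been promised to the first one, whose bundle has to be contained in
`allowed`; at most `budget` further promises are made to it. -/
structure SearchNode (m : ℕ) (ω : Type) where
  budget : ℕ
  allowed : Finset (Fin m)
  free : Finset (Fin m)
  agents : List ω

namespace SearchNode

/-- The remaining agents can be served from the vertices that are left; the promises to the first
agent need not be kept. -/
def Solvable (good : ω → Finset (Fin m) → Prop) : SearchNode m ω → Prop
  | ⟨_, _, _, []⟩ => True
  | ⟨_, U, F, a :: as⟩ => ∃ T ⊆ U, good a T ∧ Allocatable good as (F \ T)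

/-- The remaining agents can be served such that the first one receives all vertices promised to
it and at most `budget` others. -/
def Promising (good : ω → Finset (Fin m) → Prop) : SearchNode m ω → Prop
  | ⟨_, _, _, []⟩ => True
  | ⟨d, U, F, a :: as⟩ => ∃ T ⊆ U, good a T ∧ Allocatable good as (F \ T) ∧ U \ F ⊆ T ∧
      (T \ (U \ F)).card ≤ d

/-- The children of a node. If there are `K` solutions for the first agent that are disjoint
outside of the vertices promised to it, it can be served at the end and is dropped; otherwise the
vertices of a maximal collection of such solutions are hit by every solution, and one of them is
promised to the agent. -/
noncomputable def children (good : ω → Finset (Fin m) → Prop) (s K : ℕ) :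
    SearchNode m ω → List (SearchNode m ω)
  | ⟨_, _, _, []⟩ => []
  | ⟨d, U, F, a :: as⟩ =>
    if (pack (good a) (U \ F) K U).1 then [⟨s, F, F, as⟩]
    else if d = 0 then []
    else ((List.finRange m).filter (· ∈ U \ (pack (good a) (U \ F) K U).2)).map
      fun v => ⟨d - 1, U, F \ {v}, a :: as⟩

variable {good : ω → Finset (Fin m) → Prop} {s K : ℕ}

theorem Solvable.of_children (hs : ∀ a T, good a T → T.card ≤ s) {N : SearchNode m ω}
    (hK : N.agents.length ≠ 0 → (N.agents.length - 1) * s < K)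
    (h : ∃ C ∈ N.children good s K, C.Solvable good) : N.Solvable good := by
  obtain ⟨d, U, F, as⟩ := N
  cases as with
  | nil => trivial
  | cons a as =>
    obtain ⟨C, hC, h⟩ := h
    simp only [children] at hC
    split_ifs at hC with h₁ h₂
    · rw [List.mem_singleton] at hC
      subst hC
      have hA : Allocatable good as F := by
        cases as with
        | nil => trivial
        | cons b as => exact h
      obtain ⟨W, hW, hc, hA⟩ := hA.exists_small hs
      simp only [List.length_cons, Nat.add_sub_cancel] at hK
      obtain ⟨T, hTU, hT, hd⟩ := exists_disjoint_of_pack h₁ (W := W)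
        (Finset.disjoint_of_subset_left hW Finset.disjoint_sdiff)
        (hc.trans_lt (hK (by omega)))
      exact ⟨T, hTU, hT, hA.mono (Finset.subset_sdiff.2 ⟨hW, hd.symm⟩)⟩
    · simp at hC
    · obtain ⟨v, -, rfl⟩ := List.mem_map.1 hC
      obtain ⟨T, hTU, hT, hA⟩ := h
      exact ⟨T, hTU, hT, hA.mono (Finset.sdiff_subset_sdiff Finset.sdiff_subset subset_rfl)⟩

theorem Promising.exists_child (hs : ∀ a T, good a T → T.card ≤ s) {N : SearchNode m ω}
    (hN : N.agents ≠ []) (h : N.Promising good) :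
    ∃ C ∈ N.children good s K, C.Promising good := by
  obtain ⟨d, U, F, as⟩ := N
  cases as with
  | nil => simp at hN
  | cons a as =>
    obtain ⟨T, hTU, hT, hA, hR, hd⟩ := h
    by_cases h₁ : (pack (good a) (U \ F) K U).1 = true
    · refine ⟨⟨s, F, F, as⟩, by simp [children, h₁], ?_⟩
      cases as with
      | nil => trivial
      | cons b as =>
        obtain ⟨T', hT'F, hT', hA⟩ := hA.mono (Finset.sdiff_subset : F \ T ⊆ F)
        exact ⟨T', hT'F, hT', hA, by simp, by simpa using hs b T' hT'⟩
    · have hf := pack_fst_of_not_feasible (Bool.eq_false_iff.2 h₁)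
      have hdis := disjoint_sdiff_pack (good a) (U \ F) K U
      obtain ⟨x, hxT, hxP⟩ : ∃ x ∈ T, x ∉ (pack (good a) (U \ F) K U).2 := by
        by_contra! hsub
        exact hf ⟨T, hsub, hT⟩
      have hxY : x ∈ U \ (pack (good a) (U \ F) K U).2 :=
        Finset.mem_sdiff.2 ⟨hTU hxT, hxP⟩
      have hxR := Finset.disjoint_left.1 hdis hxY
      have hlt : (T \ (U \ (F \ {x}))).card < (T \ (U \ F)).card := by
        refine Finset.card_lt_card ⟨fun y hy => ?_, fun hsub => ?_⟩
        · simp only [Finset.mem_sdiff, Finset.mem_singleton] at hy ⊢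
          tauto
        · have := hsub (x := x) (Finset.mem_sdiff.2 ⟨hxT, hxR⟩)
          have hxU := hTU hxT
          simp only [Finset.mem_sdiff, Finset.mem_singleton] at this
          tauto
      have hd0 : d ≠ 0 := by omega
      refine ⟨⟨d - 1, U, F \ {x}, a :: as⟩, ?_, T, hTU, hT, hA.mono fun y hy => ?_,
        fun y hy => ?_, by omega⟩
      · simp only [children, if_neg h₁, if_neg hd0]
        exact List.mem_map.2 ⟨x, List.mem_filter.2 ⟨List.mem_finRange x, by simpa using hxY⟩, rfl⟩
      · simp only [Finset.mem_sdiff, Finset.mem_singleton] at hy ⊢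
        exact ⟨⟨hy.1, fun e => hy.2 (e ▸ hxT)⟩, hy.2⟩
      · have := hR (x := y)
        simp only [Finset.mem_sdiff, Finset.mem_singleton] at hy this
        by_cases hyx : y = x
        · exact hyx ▸ hxT
        · tauto

theorem length_agents_of_mem_children {N C : SearchNode m ω} (hC : C ∈ N.children good s K) :
    C.agents.length ≤ N.agents.length := by
  obtain ⟨d, U, F, as⟩ := N
  cases as with
  | nil => simp [children] at hC
  | cons a as =>
    simp only [children] at hC
    split_ifs at hC
    · rw [List.mem_singleton] at hC
      simp [hC]
    · simp at hC
    · obtain ⟨v, -, rfl⟩ := List.mem_map.1 hC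
      exact le_rfl

/-- A bound for the number of levels of the search tree below a node. -/
def rank (s : ℕ) (N : SearchNode m ω) : ℕ := N.agents.length * (s + 1) + N.budget

/-- A bound for the number of nodes of the search tree below a node. -/
def weight (s b : ℕ) (N : SearchNode m ω) : ℕ := (b + 2) ^ N.rank s

theorem sum_weight_children_lt (hs : ∀ a T, good a T → T.card ≤ s) (N : SearchNode m ω) :
    ((N.children good s K).map (weight s (K * s))).sum < N.weight s (K * s) := by
  obtain ⟨d, U, F, as⟩ := N
  have hpos : ∀ C : SearchNode m ω, 0 < C.weight s (K * s) := fun C => by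
    unfold weight; positivity
  cases as with
  | nil => simpa [children] using hpos _
  | cons a as =>
    simp only [children]
    split_ifs with h₁ h₂
    · simp only [List.map_cons, List.map_nil, List.sum_cons, List.sum_nil, add_zero, weight,
        rank, List.length_cons]
      exact Nat.pow_lt_pow_right (by omega) (by rw [add_mul]; omega)
    · simpa using hpos _
    · rw [List.map_map]
      have hlen : ((List.finRange m).filter
          (· ∈ U \ (pack (good a) (U \ F) K U).2)).length ≤ K * s := by
        refine le_trans (le_of_eq ?_) (card_sdiff_pack (hs a) (U \ F) K U)
        rw [← List.toFinset_card_of_nodup ((List.nodup_finRange m).filter _)]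
        congr 1
        ext x
        simp
      generalize (List.finRange m).filter (· ∈ U \ (pack (good a) (U \ F) K U).2) = L at hlen
      have hconst : (weight s (K * s) ∘ fun v => (⟨d - 1, U, F \ {v}, a :: as⟩ : SearchNode m ω))
          = fun _ => (K * s + 2) ^ ((as.length + 1) * (s + 1) + (d - 1)) := rfl
      rw [hconst, List.map_const', List.sum_replicate, smul_eq_mul]
      simp only [weight, rank, List.length_cons]
      obtain ⟨d, rfl⟩ := Nat.exists_eq_succ_of_ne_zero h₂
      simp only [Nat.succ_sub_one, Nat.succ_eq_add_one, ← add_assoc, pow_succ]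
      rw [mul_comm]
      exact Nat.mul_lt_mul_of_pos_left (by omega) (by positivity)

end SearchNode

end Search

/-! ### Data structures: unary numbers and bit masks -/

namespace SExp

/-- Natural numbers written in unary, for loop counters. -/
def unary (k : ℕ) : SExp := ofList (List.replicate k nil)

/-- A set of vertices as the list of its characteristic function. -/
def mask {m : ℕ} (U : Finset (Fin m)) : SExp :=
  ofList ((List.finRange m).map fun i => ofBool (decide (i ∈ U)))

/-- The singletons, as bit masks, in the order of the vertices. -/
def singles (m : ℕ) : SExp := ofList ((List.finRange m).map fun v => mask {v})

end SExp

namespace WhileProg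

open SExp (ofList ofBool ofNat unary mask singles)

/-- The truth value true. -/
def ttP : WhileProg := pairP nilP nilP

theorem Ev.ff {x : SExp} : Ev nilP x 1 (ofBool false) := Ev.nil

theorem Ev.tt {x : SExp} : Ev ttP x 6 (ofBool true) := Ev.nil.pair Ev.nil

/-- Difference of two bit masks. -/
def diffP : WhileProg :=
  foldrP (argP 0) (argP 1) nilP
    (pairP (condP (fstP (argP 0)) (condP (sndP (argP 0)) nilP ttP) nilP) (argP 1))

theorem Ev.diff {m : ℕ} (U V : Finset (Fin m)) {r : SExp} :
    Ev diffP (.cons (mask U) (.cons (mask V) r)) (50 * (m + 1)) (mask (U \ V)) := by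
  have h := Ev.foldr_two (L := List.finRange m) (la := argP 0) (lb := argP 1) (ini := nilP)
    (x := .cons (mask U) (.cons (mask V) r))
    (body := pairP (condP (fstP (argP 0)) (condP (sndP (argP 0)) nilP ttP) nilP) (argP 1))
    (fa := fun i => ofBool (decide (i ∈ U))) (fb := fun i => ofBool (decide (i ∈ V)))
    (b₀ := ([] : List SExp)) ofList (fun i l => ofBool (decide (i ∈ U \ V)) :: l)
    (Ev.arg 0) (Ev.arg 1) Ev.nil (t := 30) (by
      intro i l
      have h₁ : Ev (fstP (argP 0)) (.cons (.cons (ofBool (decide (i ∈ U))) (ofBool (decide (i ∈ V))))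
          (.cons (ofList l) (.cons (mask U) (.cons (mask V) r)))) 3 (ofBool (decide (i ∈ U))) :=
        (Ev.arg 0).fst
      have h₂ : Ev (sndP (argP 0)) (.cons (.cons (ofBool (decide (i ∈ U))) (ofBool (decide (i ∈ V))))
          (.cons (ofList l) (.cons (mask U) (.cons (mask V) r)))) 3 (ofBool (decide (i ∈ V))) :=
        (Ev.arg 0).snd
      refine ((Ev.cond (u := 13) (z := ofBool (decide (i ∈ U \ V))) h₁ (fun hU => ?_)
        (fun hU => ?_)).pair (Ev.arg 1)).mono (by omega)
      · refine (h₂.cond (u := 6) (fun hV => ?_) (fun hV => ?_))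
        · simp only [decide_eq_true_eq] at hU hV
          simpa [hU, hV] using Ev.ff.mono (by omega)
        · simp only [decide_eq_true_eq, decide_eq_false_iff_not] at hU hV
          simpa [hU, hV] using Ev.tt
      · simp only [decide_eq_false_iff_not] at hU
        simpa [hU] using Ev.ff.mono (by omega))
  rw [← List.map_eq_foldr] at h
  exact h.mono (by simp only [List.length_finRange]; omega)

/-- The entries of a list that belong to a bit mask. -/
def restrictP : WhileProg :=
  foldrP (argP 0) (argP 1) nilP
    (condP (fstP (argP 0)) (pairP (sndP (argP 0)) (argP 1)) (argP 1))

theorem foldr_ite_cons {α β : Type*} (p : α → Bool) (f : α → β) (L : List α) :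
    L.foldr (fun a l => if p a then f a :: l else l) [] = (L.filter p).map f := by
  induction L with
  | nil => rfl
  | cons a L ih =>
    rw [List.foldr_cons, ih, List.filter_cons]
    split_ifs <;> simp

theorem Ev.restrict {m : ℕ} (U : Finset (Fin m)) (f : Fin m → SExp) {r : SExp} :
    Ev restrictP (.cons (mask U) (.cons (ofList ((List.finRange m).map f)) r)) (50 * (m + 1))
      (ofList (((List.finRange m).filter (decide <| · ∈ U)).map f)) := by
  rw [← foldr_ite_cons]
  refine (Ev.foldr_two (L := List.finRange m)
    (fa := fun i => ofBool (decide (i ∈ U))) (fb := f) (b₀ := ([] : List SExp)) ofList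
    _ (Ev.arg 0) (Ev.arg 1) Ev.nil (t := 20) ?_).mono ?_
  · intro i l
    refine (Ev.cond (Ev.arg 0).fst (u := 10) (fun hU => ?_) (fun hU => ?_)).mono (by omega)
    · rw [if_pos hU]
      exact ((Ev.arg 0).snd.pair (Ev.arg 1)).mono (by omega)
    · rw [hU]
      exact (Ev.arg 1).mono (by omega)
  · simp only [List.length_finRange]
    omega

/-- The submatrix of a square matrix whose rows and columns belong to a bit mask. -/
def inducedP : WhileProg :=
  foldrP (argP 0) (argP 1) nilP (condP (fstP (argP 0))
    (pairP (compP restrictP (pairP (argP 2) (pairP (sndP (argP 0)) nilP))) (argP 1)) (argP 1))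

theorem Ev.induced {m : ℕ} (U : Finset (Fin m)) (f : Fin m → Fin m → SExp) {r : SExp} :
    Ev inducedP (.cons (mask U) (.cons (ofList ((List.finRange m).map fun i =>
      ofList ((List.finRange m).map (f i)))) r)) (150 * (m + 1) ^ 2)
      (ofList (((List.finRange m).filter (decide <| · ∈ U)).map fun i =>
        ofList (((List.finRange m).filter (decide <| · ∈ U)).map (f i)))) := by
  rw [← foldr_ite_cons (f := fun i =>
    ofList (((List.finRange m).filter (decide <| · ∈ U)).map (f i)))]
  refine (Ev.foldr_two (L := List.finRange m)
    (fa := fun i => ofBool (decide (i ∈ U))) (fb := fun i => ofList ((List.finRange m).map (f i)))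
    (b₀ := ([] : List SExp)) ofList
    _ (Ev.arg 0) (Ev.arg 1) Ev.nil (t := 50 * (m + 1) + 40) ?_).mono ?_
  · intro i l
    refine (Ev.cond (Ev.arg 0).fst (u := 50 * (m + 1) + 30) (fun hU => ?_)
      (fun hU => ?_)).mono (by omega)
    · rw [if_pos hU]
      exact (((Ev.restrict U (f i)).comp ((Ev.arg 2).pair ((Ev.arg 0).snd.pair Ev.nil))).pair
        (Ev.arg 1)).mono (by omega)
    · rw [hU]
      exact (Ev.arg 1).mono (by omega)
  · simp only [List.length_finRange]
    nlinarith

theorem foldr_add_one {α : Type*} (l : List α) (j : ℕ) :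
    l.foldr (fun _ k => k + 1) j = l.length + j := by
  induction l with
  | nil => simp
  | cons a l ih => rw [List.foldr_cons, ih, List.length_cons]; omega

/-- Sum of two unary numbers. -/
def appendP : WhileProg := foldrP (argP 0) nilP (argP 1) (pairP nilP (argP 1))

theorem Ev.append (i j : ℕ) {r : SExp} :
    Ev appendP (.cons (unary i) (.cons (unary j) r)) (50 * (i + 1)) (unary (i + j)) := by
  have h := foldr_add_one (List.replicate i ()) j
  rw [List.length_replicate] at h
  rw [← h]
  refine (Ev.foldr_one (L := List.replicate i ()) (fa := fun _ => .nil) (b₀ := j) unary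
    (fun _ k => k + 1) (t₁ := 2) ?_ (Ev.arg 1) (t := 10) fun _ k => ?_).mono ?_
  · rw [List.map_replicate]
    exact Ev.arg 0
  · exact (Ev.nil.pair (Ev.arg 1)).mono (by omega)
  · simp only [List.length_replicate]
    omega

theorem foldr_bit (k : ℕ) : k.bits.foldr Nat.bit 0 = k := by
  induction k using Nat.binaryRec' with
  | zero => simp
  | bit b n h ih => rw [Nat.bits_append_bit n b h, List.foldr_cons, ih]

theorem foldr_bit_le_of_suffix {l l' : List Bool} (h : l' <:+ l) :
    l'.foldr Nat.bit 0 ≤ l.foldr Nat.bit 0 := by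
  obtain ⟨l₁, rfl⟩ := h
  induction l₁ with
  | nil => exact le_rfl
  | cons b l₁ ih =>
    refine ih.trans ?_
    rw [List.cons_append, List.foldr_cons, Nat.bit_val]
    omega

/-- Conversion from binary to unary, by Horner's scheme. -/
def unaryP : WhileProg :=
  foldrP idP nilP nilP (condP (fstP (argP 0))
    (pairP nilP (compP appendP (pairP (argP 1) (pairP (argP 1) nilP))))
    (compP appendP (pairP (argP 1) (pairP (argP 1) nilP))))

theorem Ev.unary (k : ℕ) : Ev unaryP (ofNat k) (150 * (k + 1) ^ 2) (unary k) := by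
  have hlen : k.bits.length ≤ k := by
    rw [Nat.size_eq_bits_len, Nat.size_le]
    exact k.lt_two_pow_self
  have h := Ev.foldr_suffix (L := k.bits) (la := idP) (lb := nilP) (ini := nilP) (x := ofNat k)
    (body := condP (fstP (argP 0))
      (pairP nilP (compP appendP (pairP (argP 1) (pairP (argP 1) nilP))))
      (compP appendP (pairP (argP 1) (pairP (argP 1) nilP))))
    (fa := ofBool) (fb := fun _ => .nil) (b₀ := 0) SExp.unary Nat.bit
    Ev.id Ev.nil (zipPad_nil _ _) Ev.nil (t := 50 * (k + 1) + 30) (by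
      intro b l hl
      have hk := foldr_bit_le_of_suffix hl
      rw [foldr_bit, List.foldr_cons, Nat.bit_val] at hk
      rw [List.foldr_cons]
      generalize l.foldr Nat.bit 0 = j at *
      have h₁ : ∀ e r : SExp, Ev (compP appendP (pairP (argP 1) (pairP (argP 1) nilP)))
          (.cons e (.cons (SExp.unary j) r)) (50 * (k + 1) + 15) (SExp.unary (2 * j)) := by
        intro e r
        rw [two_mul]
        exact ((Ev.append j j).comp ((Ev.arg 1).pair ((Ev.arg 1).pair Ev.nil))).mono (by omega)
      refine (Ev.cond (Ev.arg 0).fst (u := 50 * (k + 1) + 20) (fun hb => ?_)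
        (fun hb => ?_)).mono (by omega)
      · rw [hb]
        exact (Ev.nil.pair (h₁ _ _)).mono (by omega)
      · rw [hb]
        exact (h₁ _ _).mono (by omega))
  rw [foldr_bit] at h
  refine h.mono ?_
  have := Nat.mul_le_mul_right (50 * (k + 1) + 30 + 12) hlen
  nlinarith

/-- The list of all singletons of vertices, as bit masks. The input is a list whose third entry is
a list with one entry for each vertex. -/
def singlesP : WhileProg :=
  sndP (foldrP (argP 2) nilP (pairP nilP nilP)
    (pairP (pairP nilP (fstP (argP 1))) (pairP (pairP ttP (fstP (argP 1)))
      (compP (foldrP idP nilP nilP (pairP (pairP nilP (fstP (argP 0))) (argP 1)))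
        (sndP (argP 1))))))

theorem singles_succ (k : ℕ) : singles (k + 1) = .cons (.cons (ofBool true) (unary k))
    (ofList ((List.finRange k).map fun v => .cons .nil (mask {v}))) := by
  have h₁ : mask ({0} : Finset (Fin (k + 1))) = .cons (ofBool true) (unary k) := by
    simp [mask, List.finRange_succ, ofList, unary, Function.comp_def, ofBool, Fin.succ_ne_zero,
      List.map_const']
  have h₂ : ∀ v : Fin k, mask ({v.succ} : Finset (Fin (k + 1))) = .cons .nil (mask {v}) := by
    intro v
    simp [mask, List.finRange_succ, ofList, Function.comp_def, ofBool, (Fin.succ_ne_zero v).symm]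
  simp [singles, List.finRange_succ, ofList, Function.comp_def, h₁, h₂]

theorem Ev.singles {m : ℕ} (f : Fin m → SExp) {a b r : SExp} :
    Ev singlesP (.cons a (.cons b (.cons (ofList ((List.finRange m).map f)) r)))
      (150 * (m + 1) ^ 2) (singles m) := by
  have h := Ev.foldr_suffix (L := List.finRange m) (la := argP 2) (lb := nilP)
    (ini := pairP nilP nilP)
    (x := .cons a (.cons b (.cons (ofList ((List.finRange m).map f)) r)))
    (body := pairP (pairP nilP (fstP (argP 1))) (pairP (pairP ttP (fstP (argP 1)))
      (compP (foldrP idP nilP nilP (pairP (pairP nilP (fstP (argP 0))) (argP 1)))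
        (sndP (argP 1)))))
    (fa := f) (fb := fun _ => .nil) (b₀ := 0)
    (fun k => .cons (SExp.unary k) (SExp.singles k)) (fun _ k => k + 1)
    (Ev.arg 2) Ev.nil (zipPad_nil _ _) (Ev.nil.pair Ev.nil) (t := 50 * (m + 1) + 30) (by
      intro v l hl
      have hk := hl.length_le
      rw [List.length_finRange, List.length_cons] at hk
      rw [List.foldr_cons, foldr_add_one, Nat.add_zero]
      generalize l.length = k at hk
      rw [singles_succ]
      have h₁ : Ev (foldrP idP nilP nilP (pairP (pairP nilP (fstP (argP 0))) (argP 1)))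
          (SExp.singles k) (k * 30 + 20)
          (ofList ((List.finRange k).map fun v => .cons .nil (mask {v}))) := by
        rw [List.map_eq_foldr]
        refine (Ev.foldr_one (L := List.finRange k) (b₀ := ([] : List SExp)) ofList
          _ Ev.id Ev.nil (t := 15) fun v l => ?_).mono ?_
        · exact ((Ev.nil.pair (Ev.arg 0).fst).pair (Ev.arg 1)).mono (by omega)
        · simp only [List.length_finRange]
          omega
      exact ((Ev.nil.pair (Ev.arg 1).fst).pair ((Ev.tt.pair (Ev.arg 1).fst).pair
        (h₁.comp (Ev.arg 1).snd))).mono (by omega))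
  rw [foldr_add_one, List.length_finRange, Nat.add_zero] at h
  refine h.snd.mono ?_
  nlinarith

end WhileProg

/-! ### The search as a program -/

namespace WhileProg

open SExp (ofList ofBool ofNat unary mask singles)

/-- The input of the decision procedure for the restriction of an instance to the vertex set `U`;
the entries of the adjacency matrix are `f i j`, and `sB`, `eB` are the two bounds. -/
def queryData {m : ℕ} (f : Fin m → Fin m → SExp) (sB eB : SExp) (w : Fin m → SExp)
    (U : Finset (Fin m)) : SExp :=
  ofList [ofList (((List.finRange m).filter (decide <| · ∈ U)).map fun i =>
      ofList (((List.finRange m).filter (decide <| · ∈ U)).map (f i))), sB, eB,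
    ofList (((List.finRange m).filter (decide <| · ∈ U)).map w)]

/-- The data that stay fixed during the search: the singletons, the number `K` of rounds of the
packing procedure, the size bound `s`, and the original input, whose entries after
the bounds `sB` and `eB` are `r`. -/
def globals {m : ℕ} (f : Fin m → Fin m → SExp) (K s : ℕ) (sB eB r : SExp) : SExp :=
  .cons (singles m) (.cons (unary K) (.cons (unary s) (.cons
    (ofList ((List.finRange m).map fun i => ofList ((List.finRange m).map (f i))))
    (.cons sB (.cons eB r)))))

/-- The input consists of a vertex set, a weight vector and the global data; the decision procedure
`p` is called for the induced subgraph. -/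
def testP (p : WhileProg) : WhileProg :=
  compP p (pairP (compP inducedP (pairP (argP 0) (pairP (argP 5) nilP))) (pairP (argP 6)
    (pairP (argP 7) (pairP (compP restrictP (pairP (argP 0) (pairP (argP 1) nilP))) nilP))))

/-- Implementation of `shrink`. The input consists of a vertex set, a weight vector and the global
data. -/
def shrinkP (p : WhileProg) : WhileProg :=
  foldrP (argP 2) nilP (argP 0)
    (condP (compP (testP p) (pairP (compP diffP (pairP (argP 1) (pairP (fstP (argP 0)) nilP)))
        (pairP (argP 3) (dropP 4))))
      (compP diffP (pairP (argP 1) (pairP (fstP (argP 0)) nilP))) (argP 1))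

/-- Implementation of `pack`. The input consists of the two sets `R` and `U`, a weight vector and
the global data. -/
def packP (p : WhileProg) : WhileProg :=
  foldrP (argP 4) nilP (pairP ttP (argP 1))
    (condP (compP (testP p) (pairP (sndP (argP 1)) (pairP (argP 4) (dropP 5))))
      (pairP ttP (compP diffP (pairP (sndP (argP 1)) (pairP (compP diffP (pairP
        (compP (shrinkP p) (pairP (sndP (argP 1)) (pairP (argP 4) (dropP 5))))
        (pairP (argP 2) nilP))) nilP))))
      (pairP nilP (sndP (argP 1))))

/-- Implementation of `SearchNode.children` for a node with at least one agent. The input consists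
of the result of the packing procedure, the node, a list of nodes and the global data; the children
are added to the list. -/
def branchP : WhileProg :=
  condP (fstP (argP 0))
    (pairP (pairP (argP 5) (pairP (fstP (sndP (sndP (argP 1)))) (pairP
      (fstP (sndP (sndP (argP 1)))) (sndP (sndP (sndP (sndP (argP 1)))))))) (argP 2))
    (condP (fstP (argP 1))
      (foldrP (compP restrictP (pairP (compP diffP (pairP (fstP (sndP (argP 1)))
          (pairP (sndP (argP 0)) nilP))) (pairP (argP 3) nilP))) nilP (argP 2)
        (pairP (pairP (sndP (fstP (argP 3))) (pairP (fstP (sndP (argP 3))) (pairP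
          (compP diffP (pairP (fstP (sndP (sndP (argP 3)))) (pairP (fstP (argP 0)) nilP)))
          (sndP (sndP (sndP (argP 3))))))) (argP 1)))
      (argP 2))

/-- The input consists of a node with at least one agent, a list of nodes and the global data; the
children of the node are added to the list. -/
def expandP (p : WhileProg) : WhileProg :=
  compP branchP (pairP (compP (packP p) (pairP (compP diffP (pairP (fstP (sndP (argP 0)))
      (pairP (fstP (sndP (sndP (argP 0)))) nilP)))
    (pairP (fstP (sndP (argP 0))) (pairP (fstP (sndP (sndP (sndP (argP 0))))) (dropP 2))))) idP)

/-- Depth-first search. The input consists of the global data followed by the list of the utility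
functions. During the search, the current value is the pair of the stack of the nodes that remain
to be visited and the answer. -/
def searchP (p : WhileProg) : WhileProg :=
  sndP (whileP
    (pairP (pairP (pairP (argP 2) (pairP (foldrP (argP 3) nilP nilP (pairP ttP (argP 1)))
      (pairP (foldrP (argP 3) nilP nilP (pairP ttP (argP 1))) (argP 6)))) nilP) nilP)
    (condP (sndP (sndP (sndP (fstP (fstP (argP 0))))))
      (pairP (compP (expandP p) (pairP (fstP (fstP (argP 0))) (pairP (sndP (fstP (argP 0)))
        (dropP 1)))) nilP)
      (pairP nilP ttP)))

/-- From the input, a list of the adjacency matrix, the size bound, the target utility and the list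
of utility functions, compute the global data for the search. -/
def setupP : WhileProg :=
  compP (pairP singlesP idP) (compP
    (pairP (foldrP (argP 4) nilP nilP (compP appendP (pairP (argP 2) (pairP (argP 1) nilP)))) idP)
    (pairP (compP unaryP (argP 1)) idP))

/-- A node of the search tree as data; `w` are the utility functions. -/
def nodeData {m : ℕ} {ω : Type} (w : ω → Fin m → SExp) (N : SearchNode m ω) : SExp :=
  .cons (unary N.budget) (.cons (mask N.allowed) (.cons (mask N.free)
    (ofList (N.agents.map fun a => ofList ((List.finRange m).map (w a))))))

section

variable {m : ℕ} {ω : Type} {f : Fin m → Fin m → SExp} {sB eB r : SExp} {K s Q : ℕ}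
  {w : ω → Fin m → SExp} {good : ω → Finset (Fin m) → Prop} {p : WhileProg}

open Classical in
theorem Ev.test {a : ω} {U : Finset (Fin m)} (hO : ∀ a U, Ev p (queryData f sB eB (w a) U) Q
      (ofBool (decide (Feasible (good a) U)))) :
    Ev (testP p) (.cons (mask U) (.cons (ofList ((List.finRange m).map (w a)))
      (globals f K s sB eB r))) (Q + 300 * (m + 1) ^ 2)
      (ofBool (decide (Feasible (good a) U))) := by
  have h :=
    ((Ev.induced U f).comp ((Ev.arg 0).pair ((Ev.arg 5).pair Ev.nil))).pair ((Ev.arg 6).pair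
      ((Ev.arg 7).pair (((Ev.restrict U (w a)).comp ((Ev.arg 0).pair ((Ev.arg 1).pair
        (Ev.nil (x := .cons (mask U) (.cons (ofList ((List.finRange m).map (w a)))
          (globals f K s sB eB r))))))).pair Ev.nil)))
  exact ((hO a U).comp h).mono (by nlinarith)

open Classical in
theorem Ev.shrink {a : ω} {U : Finset (Fin m)} (hO : ∀ a U, Ev p (queryData f sB eB (w a) U) Q
      (ofBool (decide (Feasible (good a) U)))) :
    Ev (shrinkP p) (.cons (mask U) (.cons (ofList ((List.finRange m).map (w a)))
      (globals f K s sB eB r))) ((m + 1) * (Q + 500 * (m + 1) ^ 2))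
      (mask (shrink (good a) (List.finRange m) U)) := by
  refine (Ev.foldr_one (L := List.finRange m) (fa := fun v => mask {v}) (b₀ := U) mask
    _ (Ev.arg 2) (Ev.arg 0) (t := Q + 470 * (m + 1) ^ 2) fun v A => ?_).mono ?_
  · have hM : m + 1 ≤ (m + 1) ^ 2 := Nat.le_self_pow two_ne_zero _
    have hd : Ev (compP diffP (pairP (argP 1) (pairP (fstP (argP 0)) nilP)))
        (.cons (.cons (mask {v}) .nil) (.cons (mask A) (.cons (mask U)
          (.cons (ofList ((List.finRange m).map (w a))) (globals f K s sB eB r)))))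
        (50 * (m + 1) + 15) (mask (A \ {v})) :=
      ((Ev.diff A {v}).comp ((Ev.arg 1).pair ((Ev.arg 0).fst.pair Ev.nil))).mono (by omega)
    refine (Ev.cond ((Ev.test hO (a := a)).comp (hd.pair ((Ev.arg 3).pair (Ev.drop 4))))
      (u := 50 * (m + 1) + 15) (fun h => ?_) (fun h => ?_)).mono (by omega)
    · rw [if_pos (of_decide_eq_true h)]
      exact hd
    · rw [if_neg (of_decide_eq_false h)]
      exact (Ev.arg 1).mono (by omega)
  · simp only [List.length_finRange]
    nlinarith

open Classical in
theorem Ev.pack {a : ω} {R U : Finset (Fin m)} (hO : ∀ a U, Ev p (queryData f sB eB (w a) U) Q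
      (ofBool (decide (Feasible (good a) U)))) :
    Ev (packP p) (.cons (mask R) (.cons (mask U) (.cons (ofList ((List.finRange m).map (w a)))
      (globals f K s sB eB r)))) (3 * (K + 1) * ((m + 1) * (Q + 500 * (m + 1) ^ 2)))
      (.cons (ofBool (pack (good a) R K U).1) (mask (pack (good a) R K U).2)) := by
  have hM : m + 1 ≤ (m + 1) ^ 2 := Nat.le_self_pow two_ne_zero _
  have hT : Q + 500 * (m + 1) ^ 2 ≤ (m + 1) * (Q + 500 * (m + 1) ^ 2) :=
    Nat.le_mul_of_pos_left _ (by omega)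
  have hs := fun A => Ev.shrink (K := K) (s := s) (r := r) (a := a) (U := A) hO
  generalize (m + 1) * (Q + 500 * (m + 1) ^ 2) = T at *
  refine (Ev.foldr_one (L := List.replicate K ()) (fa := fun _ => .nil) (b₀ := (true, U))
    (fun A : Bool × Finset (Fin m) => .cons (ofBool A.1) (mask A.2)) _ (t₁ := 6) ?_
    (Ev.tt.pair (Ev.arg 1)) (t := 2 * T) fun v A => ?_).mono ?_
  · rw [List.map_replicate]
    exact Ev.arg 4
  · refine (Ev.cond ((Ev.test hO (a := a)).comp ((Ev.arg 1).snd.pair ((Ev.arg 4).pair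
      (Ev.drop 5)))) (u := T + 100 * (m + 1) + 70) (fun h => ?_) (fun h => ?_)).mono (by omega)
    · rw [if_pos (of_decide_eq_true h)]
      exact (Ev.tt.pair ((Ev.diff _ _).comp ((Ev.arg 1).snd.pair (((Ev.diff _ R).comp
        (((hs A.2).comp ((Ev.arg 1).snd.pair ((Ev.arg 4).pair (Ev.drop 5)))).pair
          ((Ev.arg 2).pair Ev.nil))).pair Ev.nil)))).mono (by omega)
    · rw [if_neg (of_decide_eq_false h)]
      exact (Ev.ff.pair (Ev.arg 1).snd).mono (by omega)
  · simp only [List.length_replicate]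
    nlinarith

open Classical in
theorem Ev.branch {d : ℕ} {U F A : Finset (Fin m)} {b : Bool} {a : ω} {as : List ω}
    {l : List (SearchNode m ω)} :
    Ev branchP (.cons (.cons (ofBool b) (mask A)) (.cons (nodeData w ⟨d, U, F, a :: as⟩)
      (.cons (ofList (l.map (nodeData w))) (globals f K s sB eB r)))) (400 * (m + 1) ^ 2)
      (ofList (((if b then [⟨s, F, F, as⟩] else if d = 0 then []
        else ((List.finRange m).filter (· ∈ U \ A)).map
          fun v => ⟨d - 1, U, F \ {v}, a :: as⟩ : List (SearchNode m ω)) ++ l).map (nodeData w))) := by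
  have hM : m + 1 ≤ (m + 1) ^ 2 := Nat.le_self_pow two_ne_zero _
  refine (Ev.cond (Ev.arg 0).fst (u := 380 * (m + 1) ^ 2) (fun hb => ?_)
    (fun hb => ?_)).mono (by omega)
  · rw [if_pos hb]
    exact (((Ev.arg 5).pair ((Ev.arg 1).snd.snd.fst.pair ((Ev.arg 1).snd.snd.fst.pair
      (Ev.arg 1).snd.snd.snd.snd))).pair (Ev.arg 2)).mono (by omega)
  · rw [if_neg (by simp [hb])]
    cases d with
    | zero =>
      rw [if_pos rfl]
      exact (Ev.cond_false (t := 4) (Ev.arg 1).fst (Ev.arg 2)).mono (by omega)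
    | succ d =>
      rw [if_neg d.succ_ne_zero]
      have h := Ev.foldr_one (L := (List.finRange m).filter (· ∈ U \ A))
        (la := compP restrictP (pairP (compP diffP (pairP (fstP (sndP (argP 1)))
          (pairP (sndP (argP 0)) nilP))) (pairP (argP 3) nilP)))
        (ini := argP 2)
        (body := pairP (pairP (sndP (fstP (argP 3))) (pairP (fstP (sndP (argP 3))) (pairP
          (compP diffP (pairP (fstP (sndP (sndP (argP 3)))) (pairP (fstP (argP 0)) nilP)))
          (sndP (sndP (sndP (argP 3))))))) (argP 1))
        (x := .cons (.cons (ofBool b) (mask A)) (.cons (nodeData w ⟨d + 1, U, F, a :: as⟩)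
          (.cons (ofList (l.map (nodeData w))) (globals f K s sB eB r))))
        (fa := fun v => mask {v}) (b₀ := l) (fun l' => ofList (l'.map (nodeData w)))
        (fun v l' => ⟨d, U, F \ {v}, a :: as⟩ :: l')
        ((Ev.restrict (U \ A) fun v => mask {v}).comp (((Ev.diff U A).comp
          ((Ev.arg 1).snd.fst.pair ((Ev.arg 0).snd.pair Ev.nil))).pair ((Ev.arg 3).pair Ev.nil)))
        (Ev.arg 2) (t := 50 * (m + 1) + 80) (fun v l' =>
          ((((Ev.arg 3).fst.snd.pair ((Ev.arg 3).snd.fst.pair (((Ev.diff F {v}).comp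
            ((Ev.arg 3).snd.snd.fst.pair ((Ev.arg 0).fst.pair Ev.nil))).pair
            (Ev.arg 3).snd.snd.snd))).pair (Ev.arg 1)).mono (by omega)))
      have hfold : ∀ L : List (Fin m), L.foldr (fun v l' => (⟨d, U, F \ {v}, a :: as⟩ ::
          l' : List (SearchNode m ω))) l = (L.map fun v => ⟨d, U, F \ {v}, a :: as⟩) ++ l := by
        intro L
        induction L with
        | nil => rfl
        | cons v L ih => rw [List.foldr_cons, ih, List.map_cons, List.cons_append]
      rw [hfold] at h
      have hlen := (List.finRange m).length_filter_le (· ∈ U \ A)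
      rw [List.length_finRange] at hlen
      refine (Ev.cond_true (Ev.arg 1).fst (by simp [nodeData, SExp.unary, List.replicate_succ, ofList,
        SExp.head, SExp.tail]) h).mono ?_
      have := Nat.mul_le_mul_right (50 * (m + 1) + 80 + 12) hlen
      have hm : m * (50 * (m + 1) + 80 + 12) ≤ 142 * (m + 1) ^ 2 := by nlinarith
      omega

open Classical in
theorem Ev.expand {N : SearchNode m ω} (hN : N.agents ≠ []) {l : List (SearchNode m ω)}
    (hO : ∀ a U, Ev p (queryData f sB eB (w a) U) Q (ofBool (decide (Feasible (good a) U)))) :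
    Ev (expandP p) (.cons (nodeData w N) (.cons (ofList (l.map (nodeData w)))
      (globals f K s sB eB r))) (5 * (K + 1) * ((m + 1) * (Q + 500 * (m + 1) ^ 2)))
      (ofList ((N.children good s K ++ l).map (nodeData w))) := by
  obtain ⟨d, U, F, as⟩ := N
  cases as with
  | nil => simp at hN
  | cons a as =>
    have hM : m + 1 ≤ (m + 1) ^ 2 := Nat.le_self_pow two_ne_zero _
    have hT : Q + 500 * (m + 1) ^ 2 ≤ (m + 1) * (Q + 500 * (m + 1) ^ 2) :=
      Nat.le_mul_of_pos_left _ (by omega)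
    have hp := Ev.pack (K := K) (s := s) (r := r) (a := a) (R := U \ F) (U := U) hO
    generalize (m + 1) * (Q + 500 * (m + 1) ^ 2) = T at *
    refine (Ev.branch.comp ((hp.comp (((Ev.diff U F).comp ((Ev.arg 0).snd.fst.pair
      ((Ev.arg 0).snd.snd.fst.pair Ev.nil))).pair ((Ev.arg 0).snd.fst.pair
      ((Ev.arg 0).snd.snd.snd.fst.pair (Ev.drop 2))))).pair Ev.id)).mono ?_
    nlinarith

open Classical in
/-- Correctness and running time of the depth-first search. Each iteration replaces the top of the
stack by its children; the variant is the sum of the weights of the nodes on the stack. -/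
theorem Ev.search (hO : ∀ a U, Ev p (queryData f sB eB (w a) U) Q
      (ofBool (decide (Feasible (good a) U)))) (hs : ∀ a T, good a T → T.card ≤ s)
    (hs₀ : 0 < s) {as : List ω} (hK : as.length * s ≤ K) :
    Ev (searchP p) (globals f K s sB eB (.cons (ofList (as.map fun a =>
        ofList ((List.finRange m).map (w a)))) r))
      (((K * s + 2) ^ (as.length * (s + 1) + s) + 1) *
        (7 * (K + 1) * ((m + 1) * (Q + 500 * (m + 1) ^ 2))))
      (ofBool (decide (Allocatable good as Finset.univ))) := by
  have hM : m + 1 ≤ (m + 1) ^ 2 := Nat.le_self_pow two_ne_zero _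
  have hT : Q + 500 * (m + 1) ^ 2 ≤ (m + 1) * (Q + 500 * (m + 1) ^ 2) :=
    Nat.le_mul_of_pos_left _ (by omega)
  have hexp := fun (N : SearchNode m ω) (hN : N.agents ≠ []) (l : List (SearchNode m ω)) =>
    Ev.expand (K := K) (s := s) (l := l) hN (r := .cons (ofList (as.map fun a =>
        ofList ((List.finRange m).map (w a)))) r) hO
  generalize (m + 1) * (Q + 500 * (m + 1) ^ 2) = T at *
  -- The vertex set as a bit mask, computed from the rows of the adjacency matrix.
  have hfull : Ev (foldrP (argP 3) nilP nilP (pairP ttP (argP 1)))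
      (globals f K s sB eB (.cons (ofList (as.map fun a =>
        ofList ((List.finRange m).map (w a)))) r)) (50 * (m + 1))
      (mask (Finset.univ : Finset (Fin m))) := by
    have : mask (Finset.univ : Finset (Fin m)) =
        ofList ((List.finRange m).foldr (fun _ l => ofBool true :: l) []) := by
      rw [← List.map_eq_foldr]
      simp [mask]
    rw [this]
    refine (Ev.foldr_one (L := List.finRange m) (b₀ := ([] : List SExp)) ofList
      _ (Ev.arg 3) Ev.nil (t := 15) fun v l => ?_).mono ?_
    · exact (Ev.tt.pair (Ev.arg 1)).mono (by omega)
    · simp only [List.length_finRange]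
      omega
  have hsolv : Allocatable good as Finset.univ ↔
      (⟨s, Finset.univ, Finset.univ, as⟩ : SearchNode m ω).Solvable good := by
    cases as with
    | nil => exact Iff.rfl
    | cons a as => exact Iff.rfl
  have hprom : Allocatable good as Finset.univ →
      (⟨s, Finset.univ, Finset.univ, as⟩ : SearchNode m ω).Promising good := by
    cases as with
    | nil => exact fun _ => trivial
    | cons a as =>
      rintro ⟨S, hS, hg, h⟩
      exact ⟨S, hS, hg, h, by simp, by simpa using hs a S hg⟩
  -- As long as the answer is open, the instance is solvable if a node on the stack is, and if it is
  -- solvable then there is a promising node. A positive answer empties the stack, which also makes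
  -- the variant drop.
  obtain ⟨⟨stack, ans⟩, hev, ⟨h₁, h₂⟩, hnil⟩ := Ev.while
    (x := globals f K s sB eB (.cons (ofList (as.map fun a =>
        ofList ((List.finRange m).map (w a)))) r))
    (t := 6 * (K + 1) * T)
    (body := condP (sndP (sndP (sndP (fstP (fstP (argP 0))))))
      (pairP (compP (expandP p) (pairP (fstP (fstP (argP 0))) (pairP (sndP (fstP (argP 0)))
        (dropP 1)))) nilP)
      (pairP nilP ttP))
    (fun A : List (SearchNode m ω) × Bool => .cons (ofList (A.1.map (nodeData w))) (ofBool A.2))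
    (fun A => (A.2 = true → A.1 = [] ∧ Allocatable good as Finset.univ) ∧
      (A.2 = false → (Allocatable good as Finset.univ → ∃ N ∈ A.1, N.Promising good) ∧
        ((∃ N ∈ A.1, N.Solvable good) → Allocatable good as Finset.univ) ∧
        ∀ N ∈ A.1, N.agents.length ≤ as.length))
    (fun A => (A.1.map (SearchNode.weight s (K * s))).sum)
    (a₀ := ([⟨s, Finset.univ, Finset.univ, as⟩], false))
    ((((Ev.arg 2).pair (hfull.pair (hfull.pair (Ev.arg 6)))).pair Ev.nil).pair Ev.nil)
    ⟨by simp, fun _ => ⟨fun h => ⟨_, List.mem_singleton_self _, hprom h⟩, by simp [hsolv],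
      by simp⟩⟩ (by
      rintro ⟨stack, ans⟩ ⟨h₁, h₂⟩ hne
      cases stack with
      | nil => exact absurd rfl hne
      | cons N l =>
      cases ans with
      | true => exact absurd (h₁ rfl).1 (by simp)
      | false =>
      obtain ⟨hc, hsd, hlen⟩ := h₂ rfl
      have hpos : 0 < N.weight s (K * s) := by unfold SearchNode.weight; positivity
      obtain ⟨d, U, F, bs⟩ := N
      cases bs with
      | nil =>
        refine ⟨([], true), (Ev.cond_false (t := 7)
          (Ev.arg 0).fst.fst.snd.snd.snd (Ev.nil.pair Ev.tt)).mono (by nlinarith),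
          ⟨fun _ => ⟨rfl, hsd ⟨_, List.mem_cons_self, trivial⟩⟩, by simp⟩, ?_⟩
        simp only [List.map_nil, List.sum_nil, List.map_cons, List.sum_cons]
        omega
      | cons b bs =>
        refine ⟨(SearchNode.children good s K ⟨d, U, F, b :: bs⟩ ++ l, false), ?_,
          ⟨by simp, fun _ => ⟨fun h => ?_, ?_, ?_⟩⟩, ?_⟩
        · refine (Ev.cond_true (t := 7) (Ev.arg 0).fst.fst.snd.snd.snd ?_
            (((hexp ⟨d, U, F, b :: bs⟩ (by simp) l).comp
              ((Ev.arg 0).fst.fst.pair ((Ev.arg 0).fst.snd.pair (Ev.drop 1)))).pair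
              Ev.ff)).mono (by nlinarith)
          simp [nodeData, ofList, SExp.head, SExp.tail]
        · obtain ⟨N, hN, hp⟩ := hc h
          rcases List.mem_cons.1 hN with rfl | hN
          · obtain ⟨C, hC, hp⟩ := hp.exists_child (K := K) hs (by simp)
            exact ⟨C, List.mem_append_left _ hC, hp⟩
          · exact ⟨N, List.mem_append_right _ hN, hp⟩
        · rintro ⟨C, hC, hp⟩
          rcases List.mem_append.1 hC with hC | hC
          · refine hsd ⟨_, List.mem_cons_self, SearchNode.Solvable.of_children hs (fun _ => ?_)
              ⟨C, hC, hp⟩⟩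
            have := Nat.mul_le_mul_right s (hlen _ List.mem_cons_self)
            simp only [List.length_cons, Nat.add_sub_cancel, add_mul, one_mul] at this ⊢
            omega
          · exact hsd ⟨C, List.mem_cons_of_mem _ hC, hp⟩
        · intro C hC
          rcases List.mem_append.1 hC with hC | hC
          · exact (SearchNode.length_agents_of_mem_children hC).trans
              (hlen _ List.mem_cons_self)
          · exact hlen _ (List.mem_cons_of_mem _ hC)
        · have := SearchNode.sum_weight_children_lt (K := K) hs ⟨d, U, F, b :: bs⟩
          simp only [List.map_append, List.sum_append, List.map_cons, List.sum_cons]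
          omega)
  have hstack : stack = [] := by
    cases stack with
    | nil => rfl
    | cons N l => exact absurd hnil (by simp [ofList, nodeData, SExp.head])
  have hans : decide (Allocatable good as Finset.univ) = ans := by
    cases ans with
    | true => simpa using (h₁ rfl).2
    | false =>
      refine decide_eq_false fun h => ?_
      obtain ⟨N, hN, -⟩ := (h₂ rfl).1 h
      simp [hstack] at hN
  rw [hans]
  refine hev.snd.mono ?_
  simp only [List.map_cons, List.map_nil, List.sum_cons, List.sum_nil, SearchNode.weight,
    SearchNode.rank, add_zero]
  generalize (K * s + 2) ^ (as.length * (s + 1) + s) = μ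
  have h3 : 500 * 1 ≤ (K + 1) * T := by nlinarith
  nlinarith [Nat.zero_le (μ * ((K + 1) * T))]

theorem Ev.setup {eB : SExp} {as : List ω} :
    Ev setupP (ofList [ofList ((List.finRange m).map fun i => ofList ((List.finRange m).map (f i))),
        ofNat s, eB, ofList (as.map fun a => ofList ((List.finRange m).map (w a)))])
      (300 * (as.length + 1) * (s + 1) ^ 2 + 300 * (m + 1) ^ 2)
      (globals f (as.length * s) s (ofNat s) eB (.cons (ofList (as.map fun a =>
        ofList ((List.finRange m).map (w a)))) .nil)) := by
  have hK : as.length * s = as.foldr (fun _ k => s + k) 0 := by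
    induction as with
    | nil => simp
    | cons a as ih => rw [List.foldr_cons, ← ih, List.length_cons]; ring
  have h₁ : Ev (pairP (compP unaryP (argP 1)) idP)
      (ofList [ofList ((List.finRange m).map fun i => ofList ((List.finRange m).map (f i))),
        ofNat s, eB, ofList (as.map fun a => ofList ((List.finRange m).map (w a)))]) _
      (.cons (SExp.unary s) (ofList [ofList ((List.finRange m).map fun i =>
        ofList ((List.finRange m).map (f i))), ofNat s, eB,
          ofList (as.map fun a => ofList ((List.finRange m).map (w a)))])) :=
    ((Ev.unary s).comp (Ev.arg 1)).pair Ev.id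
  have h₂ := (Ev.foldr_one (L := as) (ini := nilP) (la := argP 4)
    (body := compP appendP (pairP (argP 2) (pairP (argP 1) nilP)))
    (fa := fun a => ofList ((List.finRange m).map (w a))) (b₀ := 0)
    (x := .cons (SExp.unary s) (ofList [ofList ((List.finRange m).map fun i =>
        ofList ((List.finRange m).map (f i))), ofNat s, eB,
          ofList (as.map fun a => ofList ((List.finRange m).map (w a)))])) SExp.unary
    (fun _ k => s + k) (Ev.arg 4) Ev.nil (t := 50 * (s + 1) + 20) fun a k =>
      ((Ev.append s k).comp ((Ev.arg 2).pair ((Ev.arg 1).pair Ev.nil))).mono (by omega)).pair Ev.id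
  rw [← hK] at h₂
  refine (((Ev.singles fun i => ofList ((List.finRange m).map (f i))).pair Ev.id).comp
    (h₂.comp h₁)).mono ?_
  have h₃ : as.length * (50 * (s + 1) + 20 + 12) ≤ as.length * (90 * (s + 1) ^ 2) :=
    Nat.mul_le_mul_left _ (by nlinarith)
  nlinarith

end

end WhileProg

/-! ### Encodings of instances and of their restrictions -/

namespace SExp

theorem size_pos (x : SExp) : 0 < x.size := by
  cases x <;> simp [size]

theorem size_ofList (l : List SExp) : (ofList l).size = (l.map size).sum + l.length + 1 := by
  induction l with
  | nil => rfl
  | cons a l ih => simp only [ofList, size, ih, List.map_cons, List.sum_cons, List.length_cons]; omega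

theorem size_ofList_le_of_sublist {l l' : List SExp} (h : l'.Sublist l) :
    (ofList l').size ≤ (ofList l).size := by
  simp only [size_ofList]
  have h₁ := (h.map size).sum_le_sum (by simp)
  have h₂ := h.length_le
  omega

theorem size_ofList_map_le {α : Type*} {f g : α → SExp} (l : List α)
    (h : ∀ a, (f a).size ≤ (g a).size) : (ofList (l.map f)).size ≤ (ofList (l.map g)).size := by
  induction l with
  | nil => exact le_rfl
  | cons a l ih =>
    have := h a
    simp only [List.map_cons, ofList, size]
    omega

theorem size_lt_of_mem {x : SExp} {l : List SExp} (h : x ∈ l) : x.size < (ofList l).size := by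
  induction l with
  | nil => simp at h
  | cons a l ih =>
    simp only [ofList, size]
    rcases List.mem_cons.1 h with rfl | h
    · omega
    · have := ih h
      omega

theorem length_lt_size (l : List SExp) : l.length < (ofList l).size := by
  rw [size_ofList]
  omega

open Classical in
theorem ofGraph_eq {m : ℕ} (G : SimpleGraph (Fin m)) :
    ofGraph G = ofList ((List.finRange m).map fun i =>
      ofList ((List.finRange m).map fun j => ofBool (decide (G.Adj i j)))) := by
  simp only [ofGraph, List.ofFn_eq_map]

theorem ofVector_eq {m : ℕ} (v : Fin m → ℕ) :
    ofVector v = ofList ((List.finRange m).map fun i => ofNat (v i)) := by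
  simp only [ofVector, List.ofFn_eq_map]

end SExp

/-- `S` is an admissible bundle for an agent with utility function `w`. -/
def GoodBundle {m : ℕ} (G : SimpleGraph (Fin m)) (s η : ℕ) (w : Fin m → ℕ)
    (S : Finset (Fin m)) : Prop :=
  G.IsIndepSet (S : Set (Fin m)) ∧ S.card ≤ s ∧ η ≤ ∑ x ∈ S, w x

/-- The restriction of an instance of MWIS to the subgraph induced by `U`, whose vertices are
numbered in their order. -/
def MWISInstance.induce {m : ℕ} (G : SimpleGraph (Fin m)) {k ρ : ℕ} (hk : 0 < k) (hρ : 0 < ρ)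
    (w : Fin m → ℕ) (U : Finset (Fin m)) : MWISInstance where
  m := ((List.finRange m).filter (decide <| · ∈ U)).length
  graph := G.comap ((List.finRange m).filter (decide <| · ∈ U)).get
  k := k
  ρ := ρ
  weight i := w (((List.finRange m).filter (decide <| · ∈ U)).get i)
  k_pos := hk
  ρ_pos := hρ

namespace MWISInstance

variable {m : ℕ} (G : SimpleGraph (Fin m)) {k ρ : ℕ} (hk : 0 < k) (hρ : 0 < ρ)
  (w : Fin m → ℕ) (U : Finset (Fin m))

theorem get_filter_injective :
    Function.Injective ((List.finRange m).filter (decide <| · ∈ U)).get :=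
  List.nodup_iff_injective_get.1 ((List.nodup_finRange m).filter _)

theorem induce_mem {𝒢 : GraphFamily} (h𝒢 : 𝒢.Hereditary) (hG : ⟨m, G⟩ ∈ 𝒢) :
    ⟨(induce G hk hρ w U).m, (induce G hk hρ w U).graph⟩ ∈ 𝒢 :=
  h𝒢 _ _ G _ hG ⟨SimpleGraph.Embedding.comap ⟨_, get_filter_injective U⟩ G⟩

theorem induce_isYes : (induce G hk hρ w U).IsYes ↔ Feasible (GoodBundle G k ρ w) U := by
  let e : Fin (induce G hk hρ w U).m ↪ Fin m := ⟨_, get_filter_injective U⟩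
  have hU : U = Finset.univ.map e := by
    ext x
    simp only [Finset.mem_map, Finset.mem_univ, true_and]
    constructor
    · intro hx
      obtain ⟨i, hi⟩ := List.get_of_mem (l := (List.finRange m).filter (decide <| · ∈ U)) (a := x)
        (by simpa using hx)
      exact ⟨i, hi⟩
    · rintro ⟨i, rfl⟩
      have := List.get_mem ((List.finRange m).filter (decide <| · ∈ U)) i
      exact of_decide_eq_true (List.mem_filter.1 this).2
  have hgood : ∀ S : Finset (Fin (induce G hk hρ w U).m), GoodBundle G k ρ w (S.map e) ↔
      (induce G hk hρ w U).graph.IsIndepSet (S : Set (Fin (induce G hk hρ w U).m)) ∧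
        S.card ≤ k ∧ ρ ≤ ∑ v ∈ S, (induce G hk hρ w U).weight v := by
    intro S
    rw [GoodBundle, Finset.card_map, Finset.sum_map, Finset.coe_map]
    refine and_congr ?_ Iff.rfl
    exact e.injective.injOn.pairwise_image
  constructor
  · rintro ⟨S, hS⟩
    refine ⟨S.map e, ?_, (hgood S).2 hS⟩
    conv_rhs => rw [hU]
    exact Finset.map_subset_map.2 (Finset.subset_univ S)
  · rintro ⟨T, hT, hg⟩
    rw [hU] at hT
    obtain ⟨S, -, rfl⟩ := Finset.subset_map_iff.1 hT
    exact ⟨S, (hgood S).1 hg⟩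

open Classical in
theorem encode_induce : (induce G hk hρ w U).encode = WhileProg.queryData
    (fun i j => SExp.ofBool (decide (G.Adj i j))) (SExp.ofNat k) (SExp.ofNat ρ)
    (fun i => SExp.ofNat (w i)) U := by
  have h : ∀ {α : Type} (g : Fin m → α), List.ofFn (fun i => g
      (((List.finRange m).filter (decide <| · ∈ U)).get i)) =
      ((List.finRange m).filter (decide <| · ∈ U)).map g := by
    intro α g
    conv_rhs => rw [← List.ofFn_get ((List.finRange m).filter (decide <| · ∈ U)), List.map_ofFn]
    rfl
  have h₁ : SExp.ofGraph (induce G hk hρ w U).graph =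
      SExp.ofList (((List.finRange m).filter (decide <| · ∈ U)).map fun i =>
        SExp.ofList (((List.finRange m).filter (decide <| · ∈ U)).map fun j =>
          SExp.ofBool (decide (G.Adj i j)))) := by
    rw [← h]
    simp only [← h]
    rfl
  have h₂ : SExp.ofVector (induce G hk hρ w U).weight =
      SExp.ofList (((List.finRange m).filter (decide <| · ∈ U)).map fun i =>
        SExp.ofNat (w i)) := by
    rw [← h]
    rfl
  rw [encode, h₁, h₂]
  rfl

end MWISInstance

namespace CFFAInstance

variable (J : CFFAInstance)

open Classical in
theorem encode_eq : J.encode = SExp.ofList [SExp.ofList ((List.finRange J.m).map fun i =>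
      SExp.ofList ((List.finRange J.m).map fun j => SExp.ofBool (decide (J.graph.Adj i j)))),
    SExp.ofNat J.s, SExp.ofNat J.η, SExp.ofList ((List.finRange J.n).map fun a =>
      SExp.ofList ((List.finRange J.m).map fun i => SExp.ofNat (J.utility a i)))] := by
  rw [encode, SExp.ofGraph_eq, List.ofFn_eq_map]
  simp only [SExp.ofVector_eq]

theorem isYes_iff : J.IsYes ↔ Allocatable (fun a => GoodBundle J.graph J.s J.η (J.utility a))
    (List.finRange J.n) Finset.univ := by
  rw [← List.ofFn_id, allocatable_ofFn]
  simp [IsYes, GoodBundle]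

theorem m_lt_size : J.m < J.encode.size := by
  rw [encode_eq]
  refine lt_trans ?_ (SExp.size_lt_of_mem List.mem_cons_self)
  simpa using SExp.length_lt_size ((List.finRange J.m).map _)

theorem size_encode_induce_le (a : Fin J.n) (U : Finset (Fin J.m)) :
    (MWISInstance.induce J.graph J.s_pos J.η_pos (J.utility a) U).encode.size ≤
      J.encode.size := by
  rw [MWISInstance.encode_induce, encode_eq, WhileProg.queryData]
  have hsub : ((List.finRange J.m).filter (decide <| · ∈ U)).Sublist (List.finRange J.m) :=
    List.filter_sublist
  generalize (List.finRange J.m).filter (decide <| · ∈ U) = L at hsub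
  have h₁ := (SExp.size_ofList_map_le L (f := fun i => SExp.ofList (L.map fun j =>
    SExp.ofBool (@decide (J.graph.Adj i j) (Classical.propDecidable _))))
    (g := fun i => SExp.ofList ((List.finRange J.m).map fun j =>
    SExp.ofBool (@decide (J.graph.Adj i j) (Classical.propDecidable _))))
    fun i => SExp.size_ofList_le_of_sublist (hsub.map _)).trans
    (SExp.size_ofList_le_of_sublist (hsub.map _))
  have h₂ := SExp.size_ofList_le_of_sublist (hsub.map fun i => SExp.ofNat (J.utility a i))
  have h₃ := SExp.size_lt_of_mem (List.mem_map_of_mem (f := fun a =>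
    SExp.ofList ((List.finRange J.m).map fun i => SExp.ofNat (J.utility a i)))
    (List.mem_finRange a))
  simp only [SExp.ofList, SExp.size] at h₁ h₂ h₃ ⊢
  omega

end CFFAInstance

/-! ### Computability of the time bound -/

theorem computable_sum_range {f : ℕ → ℕ} (hf : Computable f) :
    Computable fun k => ∑ i ∈ Finset.range k, f i := by
  have h : Computable fun k : ℕ => Nat.rec (motive := fun _ => ℕ) 0 (fun i a => a + f i) k :=
    Computable.nat_rec Computable.id (Computable.const 0)
      (Primrec.nat_add.to_comp.comp (Computable.snd.comp Computable.snd)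
        (hf.comp (Computable.fst.comp Computable.snd))).to₂
  refine h.of_eq fun k => ?_
  induction k with
  | zero => rfl
  | succ k ih => rw [Finset.sum_range_succ, ← ih]

theorem primrec_pow : Primrec₂ ((· ^ ·) : ℕ → ℕ → ℕ) := by
  have h : Primrec fun q : ℕ × ℕ =>
      Nat.rec (motive := fun _ => ℕ) 1 (fun _ a => a * q.1) q.2 :=
    Primrec.nat_rec' Primrec.snd (Primrec.const 1)
      (Primrec.nat_mul.comp (Primrec.snd.comp Primrec.snd)
        (Primrec.fst.comp Primrec.fst)).to₂
  refine h.of_eq fun q => ?_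
  induction q.2 with
  | zero => simp
  | succ k ih => simp only [pow_succ, ← ih]

/-! ### The two reductions -/

open Classical in
theorem ParamProblem.isFPT_of_ev {P : ParamProblem} {p : WhileProg} {f : ℕ → ℕ} {c : ℕ}
    (hf : Computable f) (h : ∀ I, WhileProg.Ev p (P.encode I)
      (f (P.param I) * (P.encode I).size ^ c) (SExp.ofBool (decide (P.IsYes I)))) :
    P.IsFPT := by
  refine ⟨p, f, c, hf, fun I => ?_⟩
  obtain ⟨t, ht, τ, e, hτ⟩ := h I (WhileProg.initStore (P.encode I)) (by simp [WhileProg.initStore])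
  refine ⟨t, τ, e, ht, ?_⟩
  rw [hτ]
  by_cases hy : P.IsYes I <;> simp [hy, SExp.ofBool]

/-- An instance of MWIS as an instance of CFFA with one agent. -/
def MWISInstance.toCFFA (I : MWISInstance) : CFFAInstance where
  n := 1
  m := I.m
  utility _ := I.weight
  s := I.k
  η := I.ρ
  graph := I.graph
  s_pos := I.k_pos
  η_pos := I.ρ_pos

theorem MWISInstance.toCFFA_isYes (I : MWISInstance) : I.toCFFA.IsYes ↔ I.IsYes := by
  constructor
  · rintro ⟨φ, h, -⟩
    exact ⟨φ (0 : Fin 1), h (0 : Fin 1)⟩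
  · rintro ⟨S, hS⟩
    exact ⟨fun _ => S, fun _ => hS, fun a b hab => absurd (Subsingleton.elim (α := Fin 1) a b) hab⟩

theorem MWISInstance.size_encode_toCFFA (I : MWISInstance) :
    I.toCFFA.encode.size = I.encode.size + 2 := by
  simp only [CFFAInstance.encode, MWISInstance.encode, SExp.size_ofList, toCFFA, List.ofFn_succ,
    List.ofFn_zero, List.map_cons, List.map_nil, List.sum_cons, List.sum_nil, List.length_cons,
    List.length_nil]
  omega

theorem sbMWIS_isFPT_of_sbCFFA {𝒢 : GraphFamily} (h : (sbCFFA 𝒢).IsFPT) : (sbMWIS 𝒢).IsFPT := by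
  classical
  obtain ⟨p, f, c, hf, h⟩ := h
  refine ParamProblem.isFPT_of_ev (P := sbMWIS 𝒢) (f := fun k => 3 ^ c * f (1 + k) + (p.bound + 40))
    (c := c) (p := .compP (.runP p) (.pairP (.argP 0) (.pairP (.argP 1) (.pairP (.argP 2)
      (.pairP (.pairP (.argP 3) .nilP) .nilP))))) ?_ ?_
  · exact Primrec.nat_add.to_comp.comp (Primrec.nat_mul.to_comp.comp (Computable.const _)
      (hf.comp (Primrec.nat_add.to_comp.comp (Computable.const 1) Computable.id)))
      (Computable.const _)
  · intro I
    obtain ⟨t, τ, e, ht, hτ⟩ := h ⟨I.1.toCFFA, I.2⟩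
    have hans : decide (τ 0 ≠ .nil) = decide ((sbMWIS 𝒢).IsYes I) :=
      decide_eq_decide.2 (hτ.trans I.1.toCFFA_isYes)
    have hrun := WhileProg.Ev.run e
    rw [hans] at hrun
    have hprep : WhileProg.Ev (.pairP (.argP 0) (.pairP (.argP 1) (.pairP (.argP 2)
        (.pairP (.pairP (.argP 3) .nilP) .nilP)))) I.1.encode 36 I.1.toCFFA.encode := by
      have : I.1.toCFFA.encode = .cons (SExp.ofGraph I.1.graph) (.cons (SExp.ofNat I.1.k)
          (.cons (SExp.ofNat I.1.ρ) (.cons (.cons (SExp.ofVector I.1.weight) .nil) .nil))) := by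
        simp [CFFAInstance.encode, MWISInstance.toCFFA, SExp.ofList]
      rw [this]
      exact ((WhileProg.Ev.arg 0).pair ((WhileProg.Ev.arg 1).pair ((WhileProg.Ev.arg 2).pair
        (((WhileProg.Ev.arg 3).pair WhileProg.Ev.nil).pair WhileProg.Ev.nil)))).mono (by omega)
    refine (hrun.comp hprep).mono ?_
    have hpos : 0 < I.1.encode.size := SExp.size_pos _
    have h₁ : (I.1.encode.size + 2) ^ c ≤ 3 ^ c * I.1.encode.size ^ c := by
      rw [← mul_pow]
      exact Nat.pow_le_pow_left (by omega) c
    have h₂ := Nat.one_le_pow c _ hpos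
    have h₃ : t ≤ f (1 + I.1.k) * (I.1.encode.size + 2) ^ c := by
      rw [← I.1.size_encode_toCFFA]
      exact ht
    have h₄ := Nat.mul_le_mul_left (f (1 + I.1.k)) h₁
    change _ ≤ (3 ^ c * f (1 + I.1.k) + (p.bound + 40)) * I.1.encode.size ^ c
    generalize I.1.encode.size ^ c = Y at *
    nlinarith [Nat.mul_le_mul_left (p.bound + 40) h₂]

/-- The running time of the search in terms of the parameter, up to a power of the input size. -/
def searchTime (f : ℕ → ℕ) (b k : ℕ) : ℕ :=
  (300 * (k + 1) ^ 3 + 300) + (((k ^ 3 + 2) ^ (k * (k + 1) + k) + 1) * (7 * (k ^ 2 + 1))) *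
    (∑ i ∈ Finset.range (k + 1), f i + b)

theorem computable_searchTime {f : ℕ → ℕ} (hf : Computable f) (b : ℕ) :
    Computable (searchTime f b) := by
  have add : Computable₂ ((· + ·) : ℕ → ℕ → ℕ) := Primrec.nat_add.to_comp
  have mul : Computable₂ ((· * ·) : ℕ → ℕ → ℕ) := Primrec.nat_mul.to_comp
  have pow : Computable₂ ((· ^ ·) : ℕ → ℕ → ℕ) := primrec_pow.to_comp
  have const : ∀ a : ℕ, Computable fun _ : ℕ => a := Computable.const
  have id : Computable fun k : ℕ => k := Computable.id
  have hsucc : Computable fun k : ℕ => k + 1 := add.comp id (const 1)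
  exact add.comp (add.comp (mul.comp (const 300) (pow.comp hsucc (const 3))) (const 300))
    (mul.comp (mul.comp (add.comp (pow.comp (add.comp (pow.comp id (const 3)) (const 2))
      (add.comp (mul.comp id hsucc) id)) (const 1)) (mul.comp (const 7)
        (add.comp (pow.comp id (const 2)) (const 1))))
      (add.comp ((computable_sum_range hf).comp hsucc) (const b)))

theorem search_bound_le {f : ℕ → ℕ} {b c n s m X : ℕ} (hX : m < X) :
    (300 * (n + 1) * (s + 1) ^ 2 + 300 * (m + 1) ^ 2) +
      ((n * s * s + 2) ^ (n * (s + 1) + s) + 1) * (7 * (n * s + 1) *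
        ((m + 1) * (f s * X ^ c + b + 4 + 500 * (m + 1) ^ 2))) ≤
      searchTime f (b + 504) (n + s) * X ^ (c + 3) := by
  have hX1 : 1 ≤ X := by omega
  have hM2 : (m + 1) ^ 2 ≤ X ^ 2 := Nat.pow_le_pow_left hX 2
  have hXc : 1 ≤ X ^ c := Nat.one_le_pow c X hX1
  have hX2 : 1 ≤ X ^ 2 := Nat.one_le_pow 2 X hX1
  have hX3 : 1 ≤ X ^ (c + 3) := Nat.one_le_pow _ X hX1
  have hM2' : (m + 1) ^ 2 ≤ X ^ (c + 3) :=
    hM2.trans (Nat.pow_le_pow_right hX1 (by omega))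
  have hf : f s ≤ ∑ i ∈ Finset.range (n + s + 1), f i :=
    Finset.single_le_sum (f := f) (fun _ _ => Nat.zero_le _) (Finset.mem_range.2 (by omega))
  have hn : n ≤ n + s := Nat.le_add_right _ _
  have hs : s ≤ n + s := Nat.le_add_left _ _
  unfold searchTime
  generalize n + s = k at *
  generalize ∑ i ∈ Finset.range (k + 1), f i = g at *
  have h₁ : 300 * (n + 1) * (s + 1) ^ 2 + 300 * (m + 1) ^ 2 ≤
      (300 * (k + 1) ^ 3 + 300) * X ^ (c + 3) := by
    have : (n + 1) * (s + 1) ^ 2 ≤ (k + 1) ^ 3 * X ^ (c + 3) :=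
      calc (n + 1) * (s + 1) ^ 2 ≤ (k + 1) * (k + 1) ^ 2 := by gcongr
        _ = (k + 1) ^ 3 * 1 := by ring
        _ ≤ _ := Nat.mul_le_mul_left _ hX3
    calc _ = 300 * ((n + 1) * (s + 1) ^ 2) + 300 * (m + 1) ^ 2 := by ring
      _ ≤ 300 * ((k + 1) ^ 3 * X ^ (c + 3)) + 300 * X ^ (c + 3) := by gcongr
      _ = _ := by ring
  have h₂ : (m + 1) * (f s * X ^ c + b + 4 + 500 * (m + 1) ^ 2) ≤
      (g + (b + 504)) * X ^ (c + 3) := by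
    have e₁ : f s * X ^ c ≤ g * (X ^ c * X ^ 2) :=
      Nat.mul_le_mul hf (Nat.le_mul_of_pos_right _ hX2)
    have e₂ : b + 4 ≤ (b + 4) * (X ^ c * X ^ 2) :=
      Nat.le_mul_of_pos_right _ (Nat.mul_pos hXc hX2)
    have e₃ : (m + 1) ^ 2 ≤ X ^ c * X ^ 2 := hM2.trans (Nat.le_mul_of_pos_left _ hXc)
    calc _ ≤ X * ((g + (b + 504)) * (X ^ c * X ^ 2)) := by
          refine Nat.mul_le_mul hX ?_
          generalize X ^ c * X ^ 2 = Y at *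
          nlinarith
      _ = _ := by ring
  have h₃ : (n * s * s + 2) ^ (n * (s + 1) + s) ≤ (k ^ 3 + 2) ^ (k * (k + 1) + k) := by
    calc _ ≤ (k * k * k + 2) ^ (n * (s + 1) + s) := by gcongr
      _ ≤ (k * k * k + 2) ^ (k * (k + 1) + k) := by
          refine Nat.pow_le_pow_right (by omega) ?_
          gcongr
      _ = _ := by congr 2; ring
  have h₄ : n * s + 1 ≤ k ^ 2 + 1 := by
    rw [pow_two]
    gcongr
  rw [add_mul _ _ (X ^ (c + 3))]
  refine Nat.add_le_add h₁ ?_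
  calc _ ≤ ((k ^ 3 + 2) ^ (k * (k + 1) + k) + 1) * (7 * (k ^ 2 + 1) *
        ((g + (b + 504)) * X ^ (c + 3))) := by
        refine Nat.mul_le_mul (Nat.add_le_add_right h₃ 1) (Nat.mul_le_mul ?_ h₂)
        exact Nat.mul_le_mul_left 7 h₄
    _ = _ := by ring

theorem sbCFFA_isFPT_of_sbMWIS {𝒢 : GraphFamily} (h𝒢 : 𝒢.Hereditary) (h : (sbMWIS 𝒢).IsFPT) :
    (sbCFFA 𝒢).IsFPT := by
  classical
  obtain ⟨p, f, c, hf, h⟩ := h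
  refine ParamProblem.isFPT_of_ev (P := sbCFFA 𝒢) (c := c + 3)
    (p := .compP (.searchP (.runP p)) .setupP) (computable_searchTime hf (p.bound + 504)) ?_
  rintro ⟨J, hJ⟩
  have hO : ∀ (a : Fin J.n) (U : Finset (Fin J.m)), WhileProg.Ev (.runP p) (WhileProg.queryData
      (fun i j => SExp.ofBool (decide (J.graph.Adj i j))) (SExp.ofNat J.s) (SExp.ofNat J.η)
      (fun i => SExp.ofNat (J.utility a i)) U) (f J.s * J.encode.size ^ c + p.bound + 4)
      (SExp.ofBool (decide (Feasible (GoodBundle J.graph J.s J.η (J.utility a)) U))) := by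
    intro a U
    obtain ⟨t, τ, e, ht, hτ⟩ := h ⟨MWISInstance.induce J.graph J.s_pos J.η_pos (J.utility a) U,
      MWISInstance.induce_mem _ _ _ _ _ h𝒢 hJ⟩
    have hans : decide (τ 0 ≠ .nil) =
        decide (Feasible (GoodBundle J.graph J.s J.η (J.utility a)) U) :=
      decide_eq_decide.2 (hτ.trans (MWISInstance.induce_isYes _ _ _ _ _))
    have hrun := WhileProg.Ev.run e
    rw [hans] at hrun
    have henc := MWISInstance.encode_induce J.graph J.s_pos J.η_pos (J.utility a) U
    rw [← henc]
    refine hrun.mono ?_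
    have h₁ : t ≤ f J.s * (MWISInstance.induce J.graph J.s_pos J.η_pos (J.utility a)
      U).encode.size ^ c := ht
    have h₂ := Nat.mul_le_mul_left (f J.s)
      (Nat.pow_le_pow_left (J.size_encode_induce_le a U) c)
    omega
  have hsearch := WhileProg.Ev.search hO (fun a T hT => hT.2.1) J.s_pos (K := J.n * J.s)
    (as := List.finRange J.n) (r := .nil) (by simp)
  have hsetup := WhileProg.Ev.setup (f := fun i j => SExp.ofBool (decide (J.graph.Adj i j)))
    (s := J.s) (eB := SExp.ofNat J.η) (w := fun a i => SExp.ofNat (J.utility a i))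
    (as := List.finRange J.n)
  rw [← J.encode_eq] at hsetup
  simp only [List.length_finRange] at hsearch hsetup
  have hyes : decide ((sbCFFA 𝒢).IsYes ⟨J, hJ⟩) = decide (Allocatable (fun a =>
      GoodBundle J.graph J.s J.η (J.utility a)) (List.finRange J.n) Finset.univ) :=
    decide_eq_decide.2 J.isYes_iff
  rw [hyes]
  exact (hsearch.comp hsetup).mono (search_bound_le J.m_lt_size)

theorem theorem1 (𝒢 : GraphFamily) (h𝒢 : 𝒢.Hereditary) :
    (sbCFFA 𝒢).IsFPT ↔ (sbMWIS 𝒢).IsFPT :=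
  ⟨sbMWIS_isFPT_of_sbCFFA, sbCFFA_isFPT_of_sbMWIS h𝒢⟩
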